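/- Let $\mathbf H=[\mathbf h_1,\dots,\mathbf h_K]\in\mathbb C^{M\times K}$, $K\ge 1$, have full column rank, let $\rho\ge 0$, $\mathbf x\in\mathbb C^K$, $\mathbf n\in\mathbb C^M$, and put $\mathbf z=\sqrt\rho\,\mathbf H\mathbf x+\mathbf n$, $\mathbf A=[\mathbf a_1,\dots,\mathbf a_K]=\mathbf H(\mathbf H^H\mathbf H)^{-1}$, $\mathbf r=\mathbf A^H\mathbf z$. For $\lambda>0$ and a unit roundoff $0<u<1$ let $$\gamma_n=\exp\Big(\lambda\sqrt n\,u+\frac{nu^2}{1-u}\Big)-1,\qquad c_1^{\mathrm u}=2K\Big(\gamma_{2M}+\frac{\gamma_{6K+1}}{1-2K\gamma_{2K+1}}\Big),\qquad c^{\mathrm u}=c_1^{\mathrm u}+\sqrt{2K}\,\gamma_{2M},$$ and let $\kappa_2(\mathbf B)=\|\mathbf B\|_2\|\mathbf B^{-1}\|_2$, where $\|\cdot\|_2$ is the spectral (for vectors: Euclidean) norm. Let $\mathbf r^{(l)}$ be the output of the normal-equations method in finite precision: compute $\mathbf c=\mathbf H^H\mathbf z$ and $\mathbf C=\mathbf H^H\mathbf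 H$, the Cholesky factorization $\mathbf C=\mathbf R^H\mathbf R$, and solve $\mathbf R^H\mathbf q=\mathbf c$, $\mathbf R\mathbf r=\mathbf q$ by forward and back substitution. Real and imaginary parts are computed in real arithmetic with sums accumulated from left to right, and every real operation ($+,-,\times,/,\sqrt{\ }$) returns its exact result times $1+\delta$, where the errors $\delta$ of all the operations are independent random variables of mean zero with $|\delta|\le u$. There are absolute constants $A_0,b>0$ such that the following holds for all such data. Assume $2K\gamma_{2K+1}<1$ and $c_1^{\mathrm u}\,\kappa_2(\mathbf H^H\mathbf H)<1$, and assume that the computation is backward stable in the sense that $\|\mathbf H\|_2\|\mathbf z\|_2\approx\|\mathbf H^H\mathbf z\|_2$, quantitatively $\|\mathbf H\|_2\|\mathbf z\|_2\le\tau\,\|\mathbf H^H\mathbf z\|_2$ with some $\tau\ge 1$. Then $$\mathbf r^{(l)}=\mathbf r+\Delta\mathbf r=\mathbf A^H\mathbf z+\Delta\mathbf r ,$$ where, except with probability at most $A_0K^2(M+K)\,e^{-b\lambda^2/\tau^2}$, all computed Cholesky pivots are positive (so that the method runs to completion) and $$\|\Delta\mathbf r\|_2\le c^{\mathrm u}\,\kappa_2(\mathbf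 H^H\mathbf H)\,\|\mathbf r\|_2 .$$ Moreover, for every user $k$, $$r_k^{(l)}=\sqrt\rho\,x_k+\sqrt\rho\sum_{i\ne k}\mathbf a_k^H\mathbf h_i\,x_i+\mathbf a_k^H\mathbf n+\Delta r_k=\sqrt\rho\,x_k+\mathbf a_k^H\mathbf n+\Delta r_k .$$ -/

import Mathlib

open MeasureTheory ProbabilityTheory
open scoped Matrix

noncomputable section

namespace FinitePrecisionZF

/-! ### Norms, condition number, constants -/

section Norms
open scoped Matrix.Norms.L2Operator

/-- Spectral norm of a complex matrix (operator norm for the Euclidean norms). -/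
def specNorm {m n : ℕ} (A : Matrix (Fin m) (Fin n) ℂ) : ℝ := ‖A‖

end Norms

/-- Euclidean norm of a complex vector. -/
def vecNorm {n : ℕ} (v : Fin n → ℂ) : ℝ := ‖(WithLp.toLp 2 v : EuclideanSpace ℂ (Fin n))‖

/-- Spectral condition number `‖A‖₂ ‖A⁻¹‖₂` (used for invertible `A` only). -/
def cond2 {n : ℕ} (A : Matrix (Fin n) (Fin n) ℂ) : ℝ := specNorm A * specNorm A⁻¹

/-- `γ_n = exp (λ √n u + n u² / (1 - u)) - 1`. -/
def gam (lam u : ℝ) (n : ℕ) : ℝ :=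
  Real.exp (lam * √(n : ℝ) * u + n * u ^ 2 / (1 - u)) - 1

/-- `c₁ = 2K (γ_{2M} + γ_{6K+1} / (1 - 2K γ_{2K+1}))`. -/
def c1 (lam u : ℝ) (M K : ℕ) : ℝ :=
  2 * K * (gam lam u (2 * M) +
    gam lam u (6 * K + 1) / (1 - 2 * K * gam lam u (2 * K + 1)))

/-- `c = c₁ + √(2K) γ_{2M}`. -/
def cU (lam u : ℝ) (M K : ℕ) : ℝ :=
  c1 lam u M K + √(2 * (K : ℝ)) * gam lam u (2 * M)

/-! ### Zero-forcing detection in exact arithmetic -/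

/-- The zero-forcing detection matrix `A = H (Hᴴ H)⁻¹`. -/
def zfMatrix {M K : ℕ} (H : Matrix (Fin M) (Fin K) ℂ) : Matrix (Fin M) (Fin K) ℂ :=
  H * (Hᴴ * H)⁻¹

/-! ### Elementary rounded operations

Every real operation `op` is evaluated as `(x op y) * (1 + δ)`, with its own `δ`.
A rounded operation is addressed by the task it belongs to (which entry of which object is being
computed), by the part (real or imaginary) that is being computed, and by its slot inside the
real computation.  Negation and complex conjugation are exact. -/

/-- Slots in one real computation: the `t`-th product, the `t`-th addition (or subtraction), and
the concluding division or square root. -/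
inductive Slot
  | mul (t : ℕ)
  | add (t : ℕ)
  | last

/-- Real or imaginary part. -/
inductive Part
  | re
  | im

/-- The scalar complex quantities computed by the normal-equations method. -/
inductive Task
  | rhs (i : ℕ)
  | gram (i j : ℕ)
  | chol (i j : ℕ)
  | fwd (i : ℕ)
  | bwd (i : ℕ)

/-- Addresses of the rounded real operations. -/
abbrev Op := Task × Part × Slot

/-- Rounded real inner product `∑_{t < n} x t * y t`, accumulated from left to right. -/
def flDot (ε : Slot → ℝ) (x y : ℕ → ℝ) : ℕ → ℝ
  | 0 => 0
  | 1 => x 0 * y 0 * (1 + ε (.mul 0))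
  | n + 2 =>
      (flDot ε x y (n + 1) + x (n + 1) * y (n + 1) * (1 + ε (.mul (n + 1)))) *
        (1 + ε (.add (n + 1)))

/-- Rounded real expression `a - ∑_{t < n} x t * y t`, evaluated from left to right. -/
def flSub (ε : Slot → ℝ) (a : ℝ) (x y : ℕ → ℝ) : ℕ → ℝ
  | 0 => a
  | n + 1 => (flSub ε a x y n - x n * y n * (1 + ε (.mul n))) * (1 + ε (.add n))

/-- The real sequence `(x 0, …, x (n-1), y 0, …, y (n-1))`. -/
def stack (n : ℕ) (x y : ℕ → ℝ) (t : ℕ) : ℝ := if t < n then x t else y (t - n)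

/-- Left factor of the real form of `∑_{t < n} conj (a t) * b t`: real inner products of length
`2n` with `(Re a, Im a)` and `(-Im a, Re a)` give the real and the imaginary part. -/
def leftReal (n : ℕ) (a : ℕ → ℂ) : Part → ℕ → ℝ
  | .re => stack n (fun t => (a t).re) (fun t => (a t).im)
  | .im => stack n (fun t => -(a t).im) (fun t => (a t).re)

/-- Right factor `(Re b, Im b)` of the real form of `∑_{t < n} conj (a t) * b t`. -/
def rightReal (n : ℕ) (b : ℕ → ℂ) : ℕ → ℝ :=
  stack n (fun t => (b t).re) (fun t => (b t).im)

/-- Rounded complex inner product `∑_{t < n} conj (a t) * b t`. -/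
def flDotC (ε : Part → Slot → ℝ) (n : ℕ) (a b : ℕ → ℂ) : ℂ :=
  ⟨flDot (ε .re) (leftReal n a .re) (rightReal n b) (2 * n),
   flDot (ε .im) (leftReal n a .im) (rightReal n b) (2 * n)⟩

/-- Rounded complex expression `c - ∑_{t < n} conj (a t) * b t`. -/
def flSubC (ε : Part → Slot → ℝ) (c : ℂ) (n : ℕ) (a b : ℕ → ℂ) : ℂ :=
  ⟨flSub (ε .re) c.re (leftReal n a .re) (rightReal n b) (2 * n),
   flSub (ε .im) c.im (leftReal n a .im) (rightReal n b) (2 * n)⟩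

/-- Rounded division of a complex number by a real number. -/
def flDivC (ε : Part → Slot → ℝ) (c : ℂ) (d : ℝ) : ℂ :=
  ⟨c.re / d * (1 + ε .re .last), c.im / d * (1 + ε .im .last)⟩

/-- The rounding errors of the operations of one task. -/
def taskErr (δ : Op → ℝ) (T : Task) : Part → Slot → ℝ := fun p s => δ (T, p, s)

/-! ### The normal-equations method, with one realization `δ` of the rounding errors -/

/-- Entry `(m, k)` of `H`, for natural-number indices (zero out of range). -/
def entry {M K : ℕ} (H : Matrix (Fin M) (Fin K) ℂ) (m k : ℕ) : ℂ :=
  if h : m < M ∧ k < K then H ⟨m, h.1⟩ ⟨k, h.2⟩ else 0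

/-- Entry `m` of `z`, for natural-number indices (zero out of range). -/
def ventry {M : ℕ} (z : Fin M → ℂ) (m : ℕ) : ℂ :=
  if h : m < M then z ⟨m, h⟩ else 0

/-- Step 1: the computed `c = Hᴴ z`. -/
def compRhs (δ : Op → ℝ) {M K : ℕ} (H : Matrix (Fin M) (Fin K) ℂ) (z : Fin M → ℂ) (i : ℕ) : ℂ :=
  flDotC (taskErr δ (.rhs i)) M (fun m => entry H m i) (ventry z)

/-- The computed inner product of columns `i` and `j` of `H`. -/
def compGramEntry (δ : Op → ℝ) {M K : ℕ} (H : Matrix (Fin M) (Fin K) ℂ) (i j : ℕ) : ℂ :=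
  flDotC (taskErr δ (.gram i j)) M (fun m => entry H m i) (fun m => entry H m j)

/-- Step 2: the computed Hermitian matrix `C = Hᴴ H`; its diagonal is real, its upper triangle is
computed, its lower triangle is the conjugate of the upper one. -/
def compGram (δ : Op → ℝ) {M K : ℕ} (H : Matrix (Fin M) (Fin K) ℂ) (i j : ℕ) : ℂ :=
  if i < j then compGramEntry δ H i j
  else if i = j then ((compGramEntry δ H i i).re : ℂ)
  else (starRingEnd ℂ) (compGramEntry δ H j i)

/-- The computed pivot `C i i - ∑_{k < i} |R k i|²`, when the rows above row `i` of `R` are known. -/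
def cholPivot (δ : Op → ℝ) (C R : ℕ → ℕ → ℂ) (i : ℕ) : ℝ :=
  (flSubC (taskErr δ (.chol i i)) (C i i) i (fun k => R k i) (fun k => R k i)).re

/-- The computed diagonal entry of row `i` of the Cholesky factor: rounded root of the pivot. -/
def cholDiag (δ : Op → ℝ) (C R : ℕ → ℕ → ℂ) (i : ℕ) : ℝ :=
  √(cholPivot δ C R i) * (1 + δ (.chol i i, .re, .last))

/-- Row `i` of the Cholesky factor, computed from `C` and the rows above it:
`R i j = (C i j - ∑_{k < i} conj (R k i) * R k j) / R i i` for `i < j`. -/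
def cholRow (δ : Op → ℝ) (C R : ℕ → ℕ → ℂ) (i j : ℕ) : ℂ :=
  if j < i then 0
  else if j = i then (cholDiag δ C R i : ℂ)
  else flDivC (taskErr δ (.chol i j))
    (flSubC (taskErr δ (.chol i j)) (C i j) i (fun k => R k i) (fun k => R k j))
    (cholDiag δ C R i)

/-- Step 3: Cholesky factorization `C = Rᴴ R` row by row; after `n` stages the rows `0, …, n-1` of
the upper triangular factor `R` are in place. -/
def cholRows (δ : Op → ℝ) (C : ℕ → ℕ → ℂ) : ℕ → ℕ → ℕ → ℂ
  | 0 => fun _ _ => 0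
  | n + 1 => Function.update (cholRows δ C n) n (cholRow δ C (cholRows δ C n) n)

/-- Step 4a: forward substitution for `Rᴴ q = c`; after `n` stages `q 0, …, q (n-1)` are known. -/
def fwdSubst (δ : Op → ℝ) (R : ℕ → ℕ → ℂ) (c : ℕ → ℂ) : ℕ → ℕ → ℂ
  | 0 => fun _ => 0
  | n + 1 => Function.update (fwdSubst δ R c n) n
      (flDivC (taskErr δ (.fwd n))
        (flSubC (taskErr δ (.fwd n)) (c n) n (fun k => R k n) (fwdSubst δ R c n))
        (R n n).re)

/-- Step 4b: back substitution for `R r = q` with `R` of size `K`; after `n ≤ K` stages the entries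
`r (K-1), …, r (K-n)` are known, and the next one is the entry with index `K-1-n`. -/
def bwdSubst (δ : Op → ℝ) (K : ℕ) (R : ℕ → ℕ → ℂ) (q : ℕ → ℂ) : ℕ → ℕ → ℂ
  | 0 => fun _ => 0
  | n + 1 => Function.update (bwdSubst δ K R q n) (K - 1 - n)
      (flDivC (taskErr δ (.bwd (K - 1 - n)))
        (flSubC (taskErr δ (.bwd (K - 1 - n))) (q (K - 1 - n)) n
          (fun t => (starRingEnd ℂ) (R (K - 1 - n) (K - n + t)))
          (fun t => bwdSubst δ K R q n (K - n + t)))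
        (R (K - 1 - n) (K - 1 - n)).re)

/-- The computed Cholesky factor in the normal-equations method. -/
def neFactor (δ : Op → ℝ) {M K : ℕ} (H : Matrix (Fin M) (Fin K) ℂ) : ℕ → ℕ → ℂ :=
  cholRows δ (compGram δ H) K

/-- The Cholesky factorization does not break down: all `K` computed pivots are positive. -/
def NERuns (δ : Op → ℝ) {M K : ℕ} (H : Matrix (Fin M) (Fin K) ℂ) : Prop :=
  ∀ i < K, 0 < cholPivot δ (compGram δ H) (neFactor δ H) i

/-- The output of the normal-equations method. -/
def neSolve (δ : Op → ℝ) {M K : ℕ} (H : Matrix (Fin M) (Fin K) ℂ) (z : Fin M → ℂ) :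
    Fin K → ℂ :=
  fun k => bwdSubst δ K (neFactor δ H)
    (fwdSubst δ (neFactor δ H) (compRhs δ H z) K) K k

/-! ### The probabilistic model of rounding errors -/

/-- The rounding errors are independent random variables of mean zero, bounded by the unit
roundoff `u`. -/
structure IsRoundingModel {Ω : Type*} [MeasurableSpace Ω] (μ : Measure Ω) (u : ℝ)
    (δ : Op → Ω → ℝ) : Prop where
  measurable : ∀ o, Measurable (δ o)
  bounded : ∀ o, ∀ᵐ ω ∂μ, |δ o ω| ≤ u
  mean_zero : ∀ o, ∫ ω, δ o ω ∂μ = 0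
  indep : iIndepFun δ μ

end FinitePrecisionZF

end

/-!
The failure probability carries an undetermined absolute constant `b` in its exponent, so the
random errors may be controlled at the level `θ = lam / (D τ)` with a large absolute constant `D`,
where a deviation costs probability `2 exp (-θ² / 2)`. If `lam < D τ` the claimed bound on the
probability exceeds `1`. Otherwise the second-order terms `n u²` are negligible as well, so that,
outside an event of the claimed probability, all accumulated factors `∏ (1 + δ)` differ from `1` by at most a
small multiple of `γ / τ` (`measure_not_errorsBounded_le`, `exp_sub_one_le_gam`). These products
run over fixed sets of operations. Hence Hoeffding's inequality and a union bound over
`O(K² (M + K))` products suffice, although the operands of the factorization and of the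
substitutions depend on earlier errors.

The rest is deterministic. Each computed entry satisfies its defining equation up to small
relative errors of the terms, so `|C - Rᴴ R| ≤ G |R|ᴴ |R|` for the computed Gram matrix `C` and
factor `R`, and similarly for the two triangular systems. Since the columns of `R` satisfy
`∑ₗ |Rₗⱼ|² ≤ 2 Cⱼⱼ`, all these errors together perturb the system `Hᴴ H r = Hᴴ z` by at most a
small multiple of `K γ ‖Hᴴ H‖₂ ‖r‖₂`; the error of the right-hand side is bounded by
`√K γ ‖H‖₂ ‖z‖₂ / τ`, where backward stability enters. This gives the forward error
(`vecNorm_neSolve_sub_le`).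

Positivity of the pivots is an induction. If the leading `i` pivots are positive, there is a
vector `x` with `x i = 1` that the leading `i` rows of `R` annihilate. The form of `C` at `x` then
reduces to `C i i - ∑_{l < i} |R l i|²` up to rounding errors that are small relative to
`‖R‖² ‖x‖²`, with `R` cut down to its leading `i × i` block, and to `∑_{l < i} |R l i|²`
(`le_diag_of_posDef`). As the form is bounded below by `‖x‖² / (2 ‖(Hᴴ H)⁻¹‖₂)`, the pivot is
positive (`cholPivot_pos`).
-/

namespace FinitePrecisionZF

/-! ### Backward error of rounded inner products -/

/-- In a rounded inner product of length `n`, the product of the factors `1 + δ` that meet any one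
term differs from `1` by at most `g`. The addition in slot `0` does not exist. -/
def DotGood (ε : Slot → ℝ) (n : ℕ) (g : ℝ) : Prop :=
  ∀ t < n, |(1 + ε (.mul t)) * ∏ s ∈ Finset.Ico (max 1 t) n, (1 + ε (.add s)) - 1| ≤ g

/-- In a rounded expression `(a - ∑_{t < n} x t * y t) / d`, or the square root in place of the
division, the products of the factors `1 + δ` that meet any one term, and the last factor, differ
from `1` by at most `g`. -/
structure SubGood (ε : Slot → ℝ) (n : ℕ) (g : ℝ) : Prop where
  tail : ∀ t < n, |(1 + ε (.mul t)) * ∏ s ∈ Finset.Ico t n, (1 + ε (.add s)) - 1| ≤ g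
  head : |∏ s ∈ Finset.range n, (1 + ε (.add s)) - 1| ≤ g
  last : |ε .last| ≤ g

lemma flDot_eq_sum (ε : Slot → ℝ) (x y : ℕ → ℝ) (n : ℕ) :
    flDot ε x y n = ∑ t ∈ Finset.range n, x t * y t *
      ((1 + ε (.mul t)) * ∏ s ∈ Finset.Ico (max 1 t) n, (1 + ε (.add s))) := by
  match n with
  | 0 => simp [flDot]
  | 1 => simp [flDot]
  | n + 2 =>
    rw [flDot, flDot_eq_sum ε x y (n + 1), Finset.sum_range_succ _ (n + 1), add_mul,
      Finset.sum_mul]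
    congr 1
    · refine Finset.sum_congr rfl fun t ht => ?_
      have ht' : t < n + 1 := Finset.mem_range.1 ht
      rw [Finset.prod_Ico_succ_top (show max 1 t ≤ n + 1 by omega)]
      ring
    · rw [Finset.prod_Ico_succ_top (show max 1 (n + 1) ≤ n + 1 by omega)]
      simp
      ring

lemma flSub_eq_sum (ε : Slot → ℝ) (a : ℝ) (x y : ℕ → ℝ) (n : ℕ) :
    flSub ε a x y n = a * ∏ s ∈ Finset.range n, (1 + ε (.add s)) -
      ∑ t ∈ Finset.range n, x t * y t *
        ((1 + ε (.mul t)) * ∏ s ∈ Finset.Ico t n, (1 + ε (.add s))) := by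
  induction n with
  | zero => simp [flSub]
  | succ n ih =>
    rw [flSub, ih, Finset.sum_range_succ, Finset.prod_range_succ]
    have : ∑ t ∈ Finset.range n, x t * y t *
        ((1 + ε (.mul t)) * ∏ s ∈ Finset.Ico t (n + 1), (1 + ε (.add s))) =
        (∑ t ∈ Finset.range n, x t * y t *
        ((1 + ε (.mul t)) * ∏ s ∈ Finset.Ico t n, (1 + ε (.add s)))) * (1 + ε (.add n)) := by
      rw [Finset.sum_mul]
      refine Finset.sum_congr rfl fun t ht => ?_
      rw [Finset.prod_Ico_succ_top (by simp at ht; omega)]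
      ring
    rw [this]
    simp
    ring

lemma flSub_congr (ε : Slot → ℝ) (a : ℝ) {x y x' y' : ℕ → ℝ} {n : ℕ}
    (hx : ∀ t < n, x t = x' t) (hy : ∀ t < n, y t = y' t) :
    flSub ε a x y n = flSub ε a x' y' n := by
  simp only [flSub_eq_sum]
  congr 1
  refine Finset.sum_congr rfl fun t ht => ?_
  rw [hx t (Finset.mem_range.1 ht), hy t (Finset.mem_range.1 ht)]

/-- A sum of terms `x t * y t`, each perturbed by a relative error of at most `g`. -/
lemma abs_weighted_sum_sub_le {n : ℕ} {g : ℝ} (x y w : ℕ → ℝ) (hw : ∀ t < n, |w t - 1| ≤ g) :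
    |∑ t ∈ Finset.range n, x t * y t * w t - ∑ t ∈ Finset.range n, x t * y t| ≤
      g * ∑ t ∈ Finset.range n, |x t| * |y t| := by
  rw [← Finset.sum_sub_distrib, Finset.mul_sum]
  refine (Finset.abs_sum_le_sum_abs _ _).trans (Finset.sum_le_sum fun t ht => ?_)
  rw [show x t * y t * w t - x t * y t = (w t - 1) * (x t * y t) by ring, abs_mul, abs_mul]
  exact mul_le_mul_of_nonneg_right (hw t (Finset.mem_range.1 ht)) (by positivity)

lemma abs_flDot_sub_le {ε : Slot → ℝ} {n : ℕ} {g : ℝ} (h : DotGood ε n g) (x y : ℕ → ℝ) :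
    |flDot ε x y n - ∑ t ∈ Finset.range n, x t * y t| ≤
      g * ∑ t ∈ Finset.range n, |x t| * |y t| := by
  rw [flDot_eq_sum]
  exact abs_weighted_sum_sub_le x y _ h

/-- The error of a rounded `a - ∑ x t * y t`, in terms of the minuend. -/
lemma abs_flSub_sub_le {ε : Slot → ℝ} {n : ℕ} {g : ℝ} (h : SubGood ε n g) (a : ℝ)
    (x y : ℕ → ℝ) :
    |flSub ε a x y n - (a - ∑ t ∈ Finset.range n, x t * y t)| ≤
      g * (|a| + ∑ t ∈ Finset.range n, |x t| * |y t|) := by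
  have h1 := abs_weighted_sum_sub_le x y _ h.tail
  have h2 : |a * (∏ s ∈ Finset.range n, (1 + ε (.add s)) - 1)| ≤ g * |a| := by
    rw [abs_mul, mul_comm]
    exact mul_le_mul_of_nonneg_right h.head (abs_nonneg a)
  rw [flSub_eq_sum]
  rw [abs_le] at *
  constructor <;> linarith [h1.1, h1.2, h2.1, h2.2]

/-- The error of a rounded `a - ∑ x t * y t`, in terms of the computed value. -/
lemma abs_flSub_sub_le' {ε : Slot → ℝ} {n : ℕ} {g : ℝ} (h : SubGood ε n g) (hg : g ≤ 1 / 2)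
    (a : ℝ) (x y : ℕ → ℝ) :
    |a - ∑ t ∈ Finset.range n, x t * y t - flSub ε a x y n| ≤
      5 * g * (|flSub ε a x y n| + ∑ t ∈ Finset.range n, |x t| * |y t|) := by
  have hg0 : 0 ≤ g := (abs_nonneg _).trans h.last
  have h1 := abs_flSub_sub_le h a x y
  have h2 : |∑ t ∈ Finset.range n, x t * y t| ≤ ∑ t ∈ Finset.range n, |x t| * |y t| :=
    (Finset.abs_sum_le_sum_abs _ _).trans_eq (Finset.sum_congr rfl fun t _ => abs_mul _ _)
  set v := flSub ε a x y n
  set S := ∑ t ∈ Finset.range n, x t * y t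
  set T := ∑ t ∈ Finset.range n, |x t| * |y t|
  have hT : 0 ≤ T := Finset.sum_nonneg fun t _ => by positivity
  have h3 : |a| ≤ |v| + |S| + g * (|a| + T) := by
    calc |a| = |v + S - (v - (a - S))| := by congr 1; ring
      _ ≤ |v + S| + |v - (a - S)| := abs_sub _ _
      _ ≤ _ := by linarith [abs_add_le v S]
  have h4 : |a| ≤ 2 * |v| + 3 * T := by
    have := mul_le_mul_of_nonneg_right hg (abs_nonneg a)
    have := mul_le_mul_of_nonneg_right hg hT
    linarith
  rw [abs_sub_comm]
  refine h1.trans ?_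
  have := mul_le_mul_of_nonneg_left h4 hg0
  nlinarith [abs_nonneg v, mul_nonneg hg0 hT, mul_nonneg hg0 (abs_nonneg v)]

/-- Backward error of a rounded quotient `y = (a - ∑ x t * y t) / d`: the defining equation
`a = ∑ x t * y t + y * d` holds up to relative errors of its terms on the right. -/
lemma abs_sub_flSub_div_le {ε : Slot → ℝ} {n : ℕ} {g : ℝ} (h : SubGood ε n g) (hg : g ≤ 1 / 2)
    (a : ℝ) (x y : ℕ → ℝ) {d : ℝ} (hd : d ≠ 0) :
    |a - ∑ t ∈ Finset.range n, x t * y t - flSub ε a x y n / d * (1 + ε .last) * d| ≤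
      12 * g * (∑ t ∈ Finset.range n, |x t| * |y t| +
        |flSub ε a x y n / d * (1 + ε .last)| * |d|) := by
  have hg0 : 0 ≤ g := (abs_nonneg _).trans h.last
  have h1 := abs_flSub_sub_le' h hg a x y
  set v := flSub ε a x y n
  set T := ∑ t ∈ Finset.range n, |x t| * |y t|
  have hT : 0 ≤ T := Finset.sum_nonneg fun t _ => by positivity
  have hw : v / d * (1 + ε .last) * d = v * (1 + ε .last) := by field_simp
  have hl := abs_le.1 h.last
  have hv : |v| ≤ 2 * |v * (1 + ε .last)| := by
    rw [abs_mul, abs_of_nonneg (by linarith : 0 ≤ 1 + ε .last)]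
    nlinarith [abs_nonneg v]
  have h2 : |v - v * (1 + ε .last)| ≤ g * |v| := by
    rw [show v - v * (1 + ε .last) = -(ε .last * v) by ring, abs_neg, abs_mul]
    exact mul_le_mul_of_nonneg_right h.last (abs_nonneg v)
  rw [← abs_mul, hw]
  have h3 := abs_sub_le (a - ∑ t ∈ Finset.range n, x t * y t) v (v * (1 + ε .last))
  nlinarith [mul_le_mul_of_nonneg_left hv hg0, mul_nonneg hg0 hT]

/-- Backward error of a rounded square root `r = √(a - ∑ x t * y t)`. -/
lemma abs_sub_sqrt_flSub_sq_le {ε : Slot → ℝ} {n : ℕ} {g : ℝ} (h : SubGood ε n g)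
    (hg : g ≤ 1 / 2) (a : ℝ) (x y : ℕ → ℝ) (hp : 0 ≤ flSub ε a x y n) :
    |a - ∑ t ∈ Finset.range n, x t * y t - (√(flSub ε a x y n) * (1 + ε .last)) ^ 2| ≤
      32 * g * (∑ t ∈ Finset.range n, |x t| * |y t| +
        (√(flSub ε a x y n) * (1 + ε .last)) ^ 2) := by
  have hg0 : 0 ≤ g := (abs_nonneg _).trans h.last
  have h1 := abs_flSub_sub_le' h hg a x y
  rw [mul_pow, Real.sq_sqrt hp]
  set v := flSub ε a x y n
  set T := ∑ t ∈ Finset.range n, |x t| * |y t|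
  have hT : 0 ≤ T := Finset.sum_nonneg fun t _ => by positivity
  rw [abs_of_nonneg hp] at h1
  have hl := abs_le.1 h.last
  have hv : v ≤ 4 * (v * (1 + ε .last) ^ 2) := by
    nlinarith [mul_nonneg hp (by nlinarith : 0 ≤ (1 + ε .last) ^ 2 - 1 / 4)]
  have h2 : |v - v * (1 + ε .last) ^ 2| ≤ 3 * g * v := by
    rw [show v - v * (1 + ε .last) ^ 2 = -(ε .last * (2 + ε .last) * v) by ring, abs_neg, abs_mul,
      abs_mul, abs_of_nonneg hp, abs_of_nonneg (by linarith : 0 ≤ 2 + ε .last)]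
    refine mul_le_mul_of_nonneg_right ?_ hp
    nlinarith [h.last, abs_nonneg (ε .last)]
  have h3 := abs_sub_le (a - ∑ t ∈ Finset.range n, x t * y t) v (v * (1 + ε .last) ^ 2)
  nlinarith [mul_le_mul_of_nonneg_left hv hg0, mul_nonneg hg0 hT]

/-! ### Complex arithmetic through real parts -/

lemma sum_range_two_mul_stack (n : ℕ) (f : ℝ → ℝ → ℝ) (x y x' y' : ℕ → ℝ) :
    ∑ t ∈ Finset.range (2 * n), f (stack n x y t) (stack n x' y' t) =
      ∑ t ∈ Finset.range n, (f (x t) (x' t) + f (y t) (y' t)) := by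
  rw [two_mul, Finset.sum_range_add, Finset.sum_add_distrib]
  congr 1
  · refine Finset.sum_congr rfl fun t ht => ?_
    simp [stack, Finset.mem_range.1 ht]
  · refine Finset.sum_congr rfl fun t _ => ?_
    simp [stack]

lemma sum_leftReal_re (n : ℕ) (a b : ℕ → ℂ) :
    ∑ t ∈ Finset.range (2 * n), leftReal n a .re t * rightReal n b t =
      (∑ t ∈ Finset.range n, (starRingEnd ℂ) (a t) * b t).re := by
  rw [leftReal, rightReal, sum_range_two_mul_stack n (· * ·), Complex.re_sum]
  simp

lemma sum_leftReal_im (n : ℕ) (a b : ℕ → ℂ) :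
    ∑ t ∈ Finset.range (2 * n), leftReal n a .im t * rightReal n b t =
      (∑ t ∈ Finset.range n, (starRingEnd ℂ) (a t) * b t).im := by
  rw [leftReal, rightReal, sum_range_two_mul_stack n (· * ·), Complex.im_sum]
  refine Finset.sum_congr rfl fun t _ => ?_
  simp
  ring

lemma sum_abs_leftReal_le (n : ℕ) (a b : ℕ → ℂ) (p : Part) :
    ∑ t ∈ Finset.range (2 * n), |leftReal n a p t| * |rightReal n b t| ≤
      ∑ t ∈ Finset.range n, ‖a t‖ * ‖b t‖ := by
  have key : ∀ x y x' y' : ℝ, |x| * |x'| + |y| * |y'| ≤ √(x ^ 2 + y ^ 2) * √(x' ^ 2 + y' ^ 2) := by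
    intro x y x' y'
    rw [← Real.sqrt_mul (by positivity)]
    apply Real.le_sqrt_of_sq_le
    nlinarith [sq_nonneg (|x| * |y'| - |y| * |x'|), sq_abs x, sq_abs y, sq_abs x', sq_abs y']
  have hn : ∀ z : ℂ, ‖z‖ = √(z.re ^ 2 + z.im ^ 2) := fun z => by
    rw [Complex.norm_def, Complex.normSq_apply]; ring_nf
  cases p
  · rw [leftReal, rightReal, sum_range_two_mul_stack n (fun u v => |u| * |v|)]
    refine Finset.sum_le_sum fun t _ => ?_
    rw [hn, hn]
    exact key _ _ _ _
  · rw [leftReal, rightReal, sum_range_two_mul_stack n (fun u v => |u| * |v|)]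
    refine Finset.sum_le_sum fun t _ => ?_
    rw [hn, hn, add_comm ((a t).re ^ 2), ← neg_sq (a t).im]
    exact key _ _ _ _

lemma re_sum_conj_mul_self (s : Finset ℕ) (a : ℕ → ℂ) :
    (∑ l ∈ s, (starRingEnd ℂ) (a l) * a l).re = ∑ l ∈ s, ‖a l‖ ^ 2 := by
  rw [Complex.re_sum]
  refine Finset.sum_congr rfl fun l _ => ?_
  rw [mul_comm, Complex.mul_conj, Complex.normSq_eq_norm_sq, Complex.ofReal_re]

lemma sum_conj_mul_self_eq_ofReal_re (s : Finset ℕ) (a : ℕ → ℂ) :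
    ∑ l ∈ s, (starRingEnd ℂ) (a l) * a l =
      ((∑ l ∈ s, (starRingEnd ℂ) (a l) * a l).re : ℂ) := by
  refine (Complex.conj_eq_iff_re.1 ?_).symm
  rw [map_sum]
  exact Finset.sum_congr rfl fun l _ => by simp [mul_comm]

lemma norm_flDotC_sub_le {ε : Part → Slot → ℝ} {n : ℕ} {g : ℝ}
    (h : ∀ p, DotGood (ε p) (2 * n) g) (hg : 0 ≤ g) (a b : ℕ → ℂ) :
    ‖flDotC ε n a b - ∑ t ∈ Finset.range n, (starRingEnd ℂ) (a t) * b t‖ ≤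
      2 * g * ∑ t ∈ Finset.range n, ‖a t‖ * ‖b t‖ := by
  have h1 := abs_flDot_sub_le (h .re) (leftReal n a .re) (rightReal n b)
  have h2 := abs_flDot_sub_le (h .im) (leftReal n a .im) (rightReal n b)
  rw [sum_leftReal_re] at h1
  rw [sum_leftReal_im] at h2
  have h3 := mul_le_mul_of_nonneg_left (sum_abs_leftReal_le n a b .re) hg
  have h4 := mul_le_mul_of_nonneg_left (sum_abs_leftReal_le n a b .im) hg
  refine (Complex.norm_le_abs_re_add_abs_im _).trans ?_
  rw [Complex.sub_re, Complex.sub_im]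
  simp only [flDotC]
  linarith

lemma leftReal_congr {n : ℕ} {a a' : ℕ → ℂ} (h : ∀ t < n, a t = a' t) (p : Part) :
    ∀ t < 2 * n, leftReal n a p t = leftReal n a' p t := by
  intro t ht
  cases p <;> simp only [leftReal, stack] <;> split_ifs with h' <;>
    first | rw [h t h'] | rw [h (t - n) (by omega)]

lemma rightReal_congr {n : ℕ} {a a' : ℕ → ℂ} (h : ∀ t < n, a t = a' t) :
    ∀ t < 2 * n, rightReal n a t = rightReal n a' t :=
  leftReal_congr h .re

lemma flSubC_congr (ε : Part → Slot → ℝ) (c : ℂ) {n : ℕ} {a b a' b' : ℕ → ℂ}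
    (ha : ∀ t < n, a t = a' t) (hb : ∀ t < n, b t = b' t) :
    flSubC ε c n a b = flSubC ε c n a' b' := by
  simp only [flSubC]
  congr 1
  · exact flSub_congr _ _ (leftReal_congr ha _) (rightReal_congr hb)
  · exact flSub_congr _ _ (leftReal_congr ha _) (rightReal_congr hb)

/-- Backward error of a rounded complex quotient with real denominator. -/
lemma norm_sub_flDivC_flSubC_le {ε : Part → Slot → ℝ} {n : ℕ} {g : ℝ}
    (h : ∀ p, SubGood (ε p) (2 * n) g) (hg : g ≤ 1 / 2) (c : ℂ) (a b : ℕ → ℂ) {d : ℝ}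
    (hd : d ≠ 0) :
    ‖c - ∑ t ∈ Finset.range n, (starRingEnd ℂ) (a t) * b t - flDivC ε (flSubC ε c n a b) d * d‖ ≤
      32 * g * (∑ t ∈ Finset.range n, ‖a t‖ * ‖b t‖ +
        ‖flDivC ε (flSubC ε c n a b) d‖ * ‖(d : ℂ)‖) := by
  have hg0 : 0 ≤ g := (abs_nonneg _).trans (h .re).last
  have h1 := abs_sub_flSub_div_le (h .re) hg c.re (leftReal n a .re) (rightReal n b) hd
  have h2 := abs_sub_flSub_div_le (h .im) hg c.im (leftReal n a .im) (rightReal n b) hd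
  rw [sum_leftReal_re] at h1
  rw [sum_leftReal_im] at h2
  have h3 := sum_abs_leftReal_le n a b .re
  have h4 := sum_abs_leftReal_le n a b .im
  have h5 := Complex.abs_re_le_norm (flDivC ε (flSubC ε c n a b) d)
  have h6 := Complex.abs_im_le_norm (flDivC ε (flSubC ε c n a b) d)
  rw [Complex.norm_real, Real.norm_eq_abs]
  refine (Complex.norm_le_abs_re_add_abs_im _).trans ?_
  rw [Complex.sub_re, Complex.sub_im, Complex.sub_re, Complex.sub_im, Complex.re_mul_ofReal,
    Complex.im_mul_ofReal]
  change |_ - _ - (flDivC ε (flSubC ε c n a b) d).re * d| ≤ 12 * g * (_ +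
    |(flDivC ε (flSubC ε c n a b) d).re| * |d|) at h1
  change |_ - _ - (flDivC ε (flSubC ε c n a b) d).im * d| ≤ 12 * g * (_ +
    |(flDivC ε (flSubC ε c n a b) d).im| * |d|) at h2
  have h7 := mul_le_mul_of_nonneg_right h5 (abs_nonneg d)
  have h8 := mul_le_mul_of_nonneg_right h6 (abs_nonneg d)
  have h9 := mul_le_mul_of_nonneg_left (add_le_add h3 h7) hg0
  have h10 := mul_le_mul_of_nonneg_left (add_le_add h4 h8) hg0
  have : 0 ≤ g * (∑ t ∈ Finset.range n, ‖a t‖ * ‖b t‖ +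
      ‖flDivC ε (flSubC ε c n a b) d‖ * |d|) :=
    mul_nonneg hg0 (add_nonneg (Finset.sum_nonneg fun t _ => by positivity) (by positivity))
  linarith

/-! ### Recurrences for the computed factor and the substitutions -/

section Recurrences

variable (δ : Op → ℝ) (C : ℕ → ℕ → ℂ)

lemma cholRows_eq_of_lt {n l : ℕ} (h : l < n) :
    cholRows δ C n l = cholRows δ C (l + 1) l := by
  induction n with
  | zero => omega
  | succ n ih =>
    rcases Nat.lt_succ_iff_lt_or_eq.1 h with h | rfl
    · rw [cholRows, Function.update_of_ne h.ne, ih h]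
    · rfl

lemma cholPivot_congr {R R' : ℕ → ℕ → ℂ} {i : ℕ} (h : ∀ k < i, R k = R' k) :
    cholPivot δ C R i = cholPivot δ C R' i := by
  simp only [cholPivot]
  congr 1
  exact flSubC_congr _ _ (fun t ht => by rw [h t ht]) (fun t ht => by rw [h t ht])

lemma cholRow_congr {R R' : ℕ → ℕ → ℂ} {i : ℕ} (h : ∀ k < i, R k = R' k) (j : ℕ) :
    cholRow δ C R i j = cholRow δ C R' i j := by
  have h1 : cholDiag δ C R i = cholDiag δ C R' i := by
    simp only [cholDiag, cholPivot_congr δ C h]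
  simp only [cholRow, h1]
  congr 3
  exact flSubC_congr _ _ (fun t ht => by rw [h t ht]) (fun t ht => by rw [h t ht])

/-- Every row of the computed factor satisfies the defining recurrence in terms of the final
factor. -/
lemma cholRows_apply {K i : ℕ} (hi : i < K) (j : ℕ) :
    cholRows δ C K i j = cholRow δ C (cholRows δ C K) i j := by
  rw [cholRows_eq_of_lt δ C hi, cholRows, Function.update_self]
  refine cholRow_congr δ C (fun k hk => ?_) j
  rw [cholRows_eq_of_lt δ C hk, cholRows_eq_of_lt δ C (hk.trans hi)]

variable (R : ℕ → ℕ → ℂ)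

lemma fwdSubst_eq_of_lt (c : ℕ → ℂ) {n l : ℕ} (h : l < n) :
    fwdSubst δ R c n l = fwdSubst δ R c (l + 1) l := by
  induction n with
  | zero => omega
  | succ n ih =>
    rcases Nat.lt_succ_iff_lt_or_eq.1 h with h | rfl
    · rw [fwdSubst, Function.update_of_ne h.ne, ih h]
    · rfl

lemma fwdSubst_apply (c : ℕ → ℂ) {K i : ℕ} (hi : i < K) :
    fwdSubst δ R c K i = flDivC (taskErr δ (.fwd i))
      (flSubC (taskErr δ (.fwd i)) (c i) i (fun k => R k i) (fwdSubst δ R c K)) (R i i).re := by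
  rw [fwdSubst_eq_of_lt δ R c hi, fwdSubst, Function.update_self]
  congr 1
  refine flSubC_congr _ _ (fun _ _ => rfl) (fun k hk => ?_)
  rw [fwdSubst_eq_of_lt δ R c hk, fwdSubst_eq_of_lt δ R c (hk.trans hi)]

lemma bwdSubst_eq_of_le (q : ℕ → ℂ) {K m n j : ℕ} (hm : m ≤ n) (hn : n ≤ K) (hj : K - m ≤ j) :
    bwdSubst δ K R q n j = bwdSubst δ K R q m j := by
  induction n, hm using Nat.le_induction with
  | base => rfl
  | succ n hmn ih =>
    rw [bwdSubst, Function.update_of_ne (by omega), ih (by omega)]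

lemma bwdSubst_apply (q : ℕ → ℂ) {K i : ℕ} (hi : i < K) :
    bwdSubst δ K R q K i = flDivC (taskErr δ (.bwd i))
      (flSubC (taskErr δ (.bwd i)) (q i) (K - 1 - i)
        (fun t => (starRingEnd ℂ) (R i (i + 1 + t)))
        (fun t => bwdSubst δ K R q K (i + 1 + t))) (R i i).re := by
  obtain ⟨n, hn⟩ : ∃ n, n = K - 1 - i := ⟨_, rfl⟩
  obtain rfl : i = K - 1 - n := by omega
  rw [bwdSubst_eq_of_le δ R q (m := n + 1) (by omega) le_rfl (by omega), bwdSubst,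
    Function.update_self, ← hn, show K - 1 - n + 1 = K - n by omega]
  congr 1
  refine flSubC_congr _ _ (fun _ _ => rfl) (fun t ht => ?_)
  rw [bwdSubst_eq_of_le δ R q (m := n) (n := K) (by omega) le_rfl (by omega)]

end Recurrences

/-! ### Backward errors of the factorization and the substitutions -/

/-- Hermitian symmetry of an array indexed by natural numbers; in particular its diagonal is
real. -/
def IsHermArray (C : ℕ → ℕ → ℂ) : Prop := ∀ i j, C j i = (starRingEnd ℂ) (C i j)

section Backward

variable {δ : Op → ℝ} {C : ℕ → ℕ → ℂ} {K : ℕ} {g : ℝ}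

lemma cholRows_apply_of_lt {i j : ℕ} (hi : i < K) (hj : j < i) : cholRows δ C K i j = 0 := by
  rw [cholRows_apply δ C hi, cholRow, if_pos hj]

lemma cholRows_apply_self {i : ℕ} (hi : i < K) :
    cholRows δ C K i i = (cholDiag δ C (cholRows δ C K) i : ℂ) := by
  rw [cholRows_apply δ C hi, cholRow, if_neg (lt_irrefl i), if_pos rfl]

lemma cholDiag_pos {R : ℕ → ℕ → ℂ} {i : ℕ} (h : SubGood (taskErr δ (.chol i i) .re) (2 * i) g)
    (hg : g ≤ 1 / 2) (hp : 0 < cholPivot δ C R i) : 0 < cholDiag δ C R i := by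
  have := (abs_le.1 h.last).1
  exact mul_pos (Real.sqrt_pos.2 hp) (by simp only [taskErr] at this; linarith)

/-- The product of the computed factor reproduces the upper triangle of `C`. The sum over `l < n`
stops at `min i j` because the factor is triangular. -/
lemma norm_sub_cholRows_le (hG : ∀ i < K, ∀ j < K, ∀ p, SubGood (taskErr δ (.chol i j) p) (2 * i) g)
    (hg : g ≤ 1 / 2) (hC : IsHermArray C) {n i j : ℕ} (hij : i ≤ j) (hin : i < n) (hn : n ≤ K)
    (hj : j < K) (hp : 0 < cholPivot δ C (cholRows δ C K) i) :
    ‖C i j - ∑ l ∈ Finset.range n,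
        (starRingEnd ℂ) (cholRows δ C K l i) * cholRows δ C K l j‖ ≤
      32 * g * ∑ l ∈ Finset.range n, ‖cholRows δ C K l i‖ * ‖cholRows δ C K l j‖ := by
  have hiK : i < K := by omega
  have hsub : Finset.range (i + 1) ⊆ Finset.range n := Finset.range_mono hin
  have hz : ∀ l ∈ Finset.range n, l ∉ Finset.range (i + 1) → cholRows δ C K l i = 0 := by
    intro l hl hl'
    simp only [Finset.mem_range] at hl hl'
    exact cholRows_apply_of_lt (by omega) (by omega)
  rw [← Finset.sum_subset hsub (fun l hl hl' => by rw [hz l hl hl']; simp),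
    ← Finset.sum_subset hsub (fun l hl hl' => by rw [hz l hl hl']; simp),
    Finset.sum_range_succ, Finset.sum_range_succ, cholRows_apply_self hiK, Complex.conj_ofReal]
  have hd := cholDiag_pos (C := C) (R := cholRows δ C K) (hG i hiK i hiK .re) hg hp
  rcases hij.lt_or_eq with hij | rfl
  · have := norm_sub_flDivC_flSubC_le (hG i hiK j hj) hg (C i j)
      (fun k => cholRows δ C K k i) (fun k => cholRows δ C K k j) hd.ne'
    rw [cholRows_apply δ C hiK j, cholRow, if_neg hij.not_gt, if_neg hij.ne', ← sub_sub,
      mul_comm (cholDiag δ C (cholRows δ C K) i : ℂ), mul_comm ‖(cholDiag δ C _ i : ℂ)‖]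
    exact this
  · rw [cholRows_apply_self hiK]
    have h1 := abs_sub_sqrt_flSub_sq_le (hG i hiK i hiK .re) hg (C i i).re
      (leftReal i (fun k => cholRows δ C K k i) .re) (rightReal i (fun k => cholRows δ C K k i))
      hp.le
    rw [sum_leftReal_re] at h1
    have h2 := sum_abs_leftReal_le i (fun k => cholRows δ C K k i)
      (fun k => cholRows δ C K k i) .re
    have hg0 : 0 ≤ g := (abs_nonneg _).trans (hG i hiK i hiK .re).last
    have hre : C i i = ((C i i).re : ℂ) := (Complex.conj_eq_iff_re.1 (hC i i).symm).symm
    have hs : ∑ l ∈ Finset.range i, (starRingEnd ℂ) (cholRows δ C K l i) * cholRows δ C K l i =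
        ((∑ l ∈ Finset.range i,
          (starRingEnd ℂ) (cholRows δ C K l i) * cholRows δ C K l i).re : ℂ) :=
      sum_conj_mul_self_eq_ofReal_re _ _
    rw [hre, hs, ← Complex.ofReal_mul, ← Complex.ofReal_add, ← Complex.ofReal_sub,
      Complex.norm_real, Complex.norm_real, Real.norm_eq_abs, Real.norm_eq_abs, ← sub_sub,
      abs_mul_abs_self, ← sq]
    refine h1.trans (mul_le_mul_of_nonneg_left (add_le_add_left h2 _) (by positivity))

/-- The product of the first `n` rows of the computed factor reproduces `C`, in both triangles, at
every position that these rows determine. -/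
lemma norm_sub_cholRows_le_of_lt
    (hG : ∀ i < K, ∀ j < K, ∀ p, SubGood (taskErr δ (.chol i j) p) (2 * i) g)
    (hg : g ≤ 1 / 2) (hC : IsHermArray C) {n i j : ℕ} (hin : i < n ∨ j < n) (hn : n ≤ K)
    (hi : i < K) (hj : j < K) (hp : ∀ k < n, 0 < cholPivot δ C (cholRows δ C K) k) :
    ‖C i j - ∑ l ∈ Finset.range n,
        (starRingEnd ℂ) (cholRows δ C K l i) * cholRows δ C K l j‖ ≤
      32 * g * ∑ l ∈ Finset.range n, ‖cholRows δ C K l i‖ * ‖cholRows δ C K l j‖ := by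
  rcases le_total i j with hij | hij
  · exact norm_sub_cholRows_le hG hg hC hij (by omega) hn hj (hp i (by omega))
  · have h := norm_sub_cholRows_le hG hg hC hij (by omega) hn hi (hp j (by omega))
    rw [← Complex.norm_conj, map_sub, ← hC, map_sum] at h
    simp only [map_mul, Complex.conj_conj] at h
    simpa only [mul_comm] using h

variable {R : ℕ → ℕ → ℂ}

/-- Backward error of the forward substitution, for an upper triangular `R` with positive
diagonal. -/
lemma norm_sub_fwdSubst_le (hG : ∀ i < K, ∀ p, SubGood (taskErr δ (.fwd i) p) (2 * i) g)
    (hg : g ≤ 1 / 2) (htri : ∀ i < K, ∀ j < i, R i j = 0) {d : ℕ → ℝ}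
    (hdiag : ∀ i < K, R i i = d i) (hd : ∀ i < K, 0 < d i) (c : ℕ → ℂ) {i : ℕ} (hi : i < K) :
    ‖c i - ∑ l ∈ Finset.range K, (starRingEnd ℂ) (R l i) * fwdSubst δ R c K l‖ ≤
      32 * g * ∑ l ∈ Finset.range K, ‖R l i‖ * ‖fwdSubst δ R c K l‖ := by
  have hsub : Finset.range (i + 1) ⊆ Finset.range K := Finset.range_mono hi
  have hz : ∀ l ∈ Finset.range K, l ∉ Finset.range (i + 1) → R l i = 0 := by
    intro l hl hl'
    simp only [Finset.mem_range] at hl hl'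
    exact htri l hl i (by omega)
  rw [← Finset.sum_subset hsub (fun l hl hl' => by rw [hz l hl hl']; simp),
    ← Finset.sum_subset hsub (fun l hl hl' => by rw [hz l hl hl']; simp),
    Finset.sum_range_succ, Finset.sum_range_succ, hdiag i hi, Complex.conj_ofReal, ← sub_sub]
  have := norm_sub_flDivC_flSubC_le (hG i hi) hg (c i) (fun k => R k i)
    (fwdSubst δ R c K) (hd i hi).ne'
  rw [fwdSubst_apply δ R c hi, hdiag i hi, Complex.ofReal_re, mul_comm (d i : ℂ),
    mul_comm ‖(d i : ℂ)‖]
  exact this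

/-- Backward error of the back substitution, for an upper triangular `R` with positive
diagonal. -/
lemma norm_sub_bwdSubst_le (hG : ∀ i < K, ∀ p, SubGood (taskErr δ (.bwd i) p) (2 * (K - 1 - i)) g)
    (hg : g ≤ 1 / 2) (htri : ∀ i < K, ∀ j < i, R i j = 0) {d : ℕ → ℝ}
    (hdiag : ∀ i < K, R i i = d i) (hd : ∀ i < K, 0 < d i) (q : ℕ → ℂ) {i : ℕ} (hi : i < K) :
    ‖q i - ∑ l ∈ Finset.range K, R i l * bwdSubst δ K R q K l‖ ≤
      32 * g * ∑ l ∈ Finset.range K, ‖R i l‖ * ‖bwdSubst δ K R q K l‖ := by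
  -- only the indices `l ≥ i` contribute
  have key : ∀ {A : Type} [AddCommMonoid A] (f : ℕ → A), (∀ l < i, f l = 0) →
      ∑ l ∈ Finset.range K, f l = ∑ t ∈ Finset.range (K - 1 - i), f (i + 1 + t) + f i := by
    intro A _ f hf
    obtain ⟨n, rfl⟩ : ∃ n, K = i + 1 + n := ⟨K - 1 - i, by omega⟩
    rw [Finset.sum_range_add, Finset.sum_range_succ,
      Finset.sum_eq_zero (fun l hl => hf l (Finset.mem_range.1 hl)), zero_add, add_comm,
      show i + 1 + n - 1 - i = n by omega]
  rw [key _ (fun l hl => by rw [htri i hi l hl, zero_mul]),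
    key _ (fun l hl => by rw [htri i hi l hl, norm_zero, zero_mul]), hdiag i hi, ← sub_sub]
  have := norm_sub_flDivC_flSubC_le (hG i hi) hg (q i)
    (fun t => (starRingEnd ℂ) (R i (i + 1 + t))) (fun t => bwdSubst δ K R q K (i + 1 + t))
    (hd i hi).ne'
  simp only [Complex.conj_conj, Complex.norm_conj] at this
  rw [bwdSubst_apply δ R q hi, hdiag i hi, Complex.ofReal_re, mul_comm (d i : ℂ),
    mul_comm ‖(d i : ℂ)‖]
  exact this

end Backward

/-! ### Positivity of the computed pivots -/

/-- A Hermitian-type form whose coefficients are bounded by those of `g |B|ᵀ |B|`. -/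
lemma norm_sum_conj_mul_le {s t : Finset ℕ} {E B : ℕ → ℕ → ℂ} {g : ℝ} (x : ℕ → ℂ)
    (hE : ∀ j ∈ s, ∀ k ∈ s, ‖E j k‖ ≤ g * ∑ l ∈ t, ‖B l j‖ * ‖B l k‖) :
    ‖∑ j ∈ s, ∑ k ∈ s, (starRingEnd ℂ) (x j) * E j k * x k‖ ≤
      g * ∑ l ∈ t, (∑ j ∈ s, ‖B l j‖ * ‖x j‖) ^ 2 := by
  calc _ ≤ ∑ j ∈ s, ∑ k ∈ s, ‖x j‖ * (g * ∑ l ∈ t, ‖B l j‖ * ‖B l k‖) * ‖x k‖ := by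
        refine (norm_sum_le _ _).trans (Finset.sum_le_sum fun j hj => (norm_sum_le _ _).trans
          (Finset.sum_le_sum fun k hk => ?_))
        rw [norm_mul, norm_mul, Complex.norm_conj]
        gcongr
        exact hE j hj k hk
    _ = _ := by
        simp only [sq, Finset.mul_sum, Finset.sum_mul]
        symm
        rw [Finset.sum_comm_cycle, Finset.sum_comm_cycle, Finset.sum_comm]
        refine Finset.sum_congr rfl fun j _ => ?_
        exact Finset.sum_congr rfl fun k _ => Finset.sum_congr rfl fun l _ => by ring

/-- An upper triangular system with nonzero diagonal is solvable. -/
lemma exists_solution_of_triangular {R : ℕ → ℕ → ℂ} {n : ℕ} (htri : ∀ l < n, ∀ j < l, R l j = 0)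
    (hd : ∀ l < n, R l l ≠ 0) (r : ℕ → ℂ) :
    ∃ y : ℕ → ℂ, ∀ l < n, ∑ j ∈ Finset.range n, R l j * y j = r l := by
  let A : Matrix (Fin n) (Fin n) ℂ := Matrix.of fun l j => R l j
  have hdet : IsUnit A.det := by
    have hA : A.IsUpperTriangular := fun i j hij => htri i i.2 j hij
    rw [Matrix.det_of_isUpperTriangular hA]
    exact isUnit_iff_ne_zero.2 (Finset.prod_ne_zero_iff.2 fun i _ => hd i i.2)
  let y := A⁻¹ *ᵥ fun l : Fin n => r l
  refine ⟨fun j => if h : j < n then y ⟨j, h⟩ else 0, fun l hl => ?_⟩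
  have h : (A *ᵥ y) ⟨l, hl⟩ = r l := by
    simp only [y, Matrix.mulVec_mulVec, Matrix.mul_nonsing_inv A hdet, Matrix.one_mulVec]
  rw [Finset.sum_range, ← h]
  simp [Matrix.mulVec, dotProduct, A]

/-- Lower bound for the diagonal entry that enters the pivot `i`, when the leading rows of `R`
reproduce `C` up to errors of relative size `G`. The form of `C` is evaluated at the vector `x`
with `x i = 1` that these rows annihilate; no bound on the column `i` of `R` is needed. -/
lemma le_diag_of_posDef {C R : ℕ → ℕ → ℂ} {i : ℕ} {ν G β : ℝ} (hG : 0 ≤ G)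
    (hC : ∀ x : ℕ → ℂ, ν * ∑ j ∈ Finset.range (i + 1), ‖x j‖ ^ 2 ≤
      (∑ j ∈ Finset.range (i + 1), ∑ k ∈ Finset.range (i + 1),
        (starRingEnd ℂ) (x j) * C j k * x k).re)
    (hE : ∀ j < i + 1, ∀ k < i + 1, j < i ∨ k < i →
      ‖C j k - ∑ l ∈ Finset.range i, (starRingEnd ℂ) (R l j) * R l k‖ ≤
        G * ∑ l ∈ Finset.range i, ‖R l j‖ * ‖R l k‖)
    (htri : ∀ l < i, ∀ j < l, R l j = 0) (hd : ∀ l < i, R l l ≠ 0)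
    (hβ : ∑ l ∈ Finset.range i, ∑ j ∈ Finset.range i, ‖R l j‖ ^ 2 ≤ β) (hν : 4 * G * β ≤ ν) :
    (1 - 2 * G) * ∑ l ∈ Finset.range i, ‖R l i‖ ^ 2 + ν / 2 ≤ (C i i).re := by
  obtain ⟨y, hy⟩ := exists_solution_of_triangular htri hd (fun l => - R l i)
  let x : ℕ → ℂ := fun j => if j = i then 1 else y j
  have hxi : x i = 1 := by simp [x]
  have hxj : ∀ j ∈ Finset.range i, x j = y j := fun j hj => by
    simp [x, (Finset.mem_range.1 hj).ne]
  have hker : ∀ l ∈ Finset.range i, ∑ k ∈ Finset.range (i + 1), R l k * x k = 0 := by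
    intro l hl
    rw [Finset.sum_range_succ, hxi, Finset.sum_congr rfl fun j hj => by rw [hxj j hj],
      hy l (Finset.mem_range.1 hl)]
    ring
  let E : ℕ → ℕ → ℂ := fun j k => if j = i ∧ k = i then 0 else
    C j k - ∑ l ∈ Finset.range i, (starRingEnd ℂ) (R l j) * R l k
  have hEb : ∀ j ∈ Finset.range (i + 1), ∀ k ∈ Finset.range (i + 1),
      ‖E j k‖ ≤ G * ∑ l ∈ Finset.range i, ‖R l j‖ * ‖R l k‖ := by
    intro j hj k hk
    simp only [Finset.mem_range] at hj hk
    by_cases h : j = i ∧ k = i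
    · simp only [E, if_pos h, norm_zero]
      exact mul_nonneg hG (Finset.sum_nonneg fun l _ => by positivity)
    · simp only [E, if_neg h]
      exact hE j hj k hk (by omega)
  have hbound := norm_sum_conj_mul_le x hEb
  -- the form of `C` at `x` is the form of `E` plus the defect of the last diagonal entry
  have hform : ∑ j ∈ Finset.range (i + 1), ∑ k ∈ Finset.range (i + 1),
        (starRingEnd ℂ) (x j) * C j k * x k =
      ∑ j ∈ Finset.range (i + 1), ∑ k ∈ Finset.range (i + 1),
        (starRingEnd ℂ) (x j) * E j k * x k +
        (C i i - ∑ l ∈ Finset.range i, (starRingEnd ℂ) (R l i) * R l i) := by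
    have h1 : ∀ j k, C j k = E j k + (∑ l ∈ Finset.range i, (starRingEnd ℂ) (R l j) * R l k) +
        if j = i then if k = i then
          C i i - ∑ l ∈ Finset.range i, (starRingEnd ℂ) (R l i) * R l i else 0 else 0 := by
      intro j k
      by_cases hj : j = i <;> by_cases hk : k = i <;> simp [E, hj, hk]
    have h2 : ∑ j ∈ Finset.range (i + 1), ∑ k ∈ Finset.range (i + 1), (starRingEnd ℂ) (x j) *
        (∑ l ∈ Finset.range i, (starRingEnd ℂ) (R l j) * R l k) * x k = 0 := by
      have h3 : ∀ j, ∑ k ∈ Finset.range (i + 1), (starRingEnd ℂ) (x j) *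
          (∑ l ∈ Finset.range i, (starRingEnd ℂ) (R l j) * R l k) * x k = 0 := by
        intro j
        simp only [Finset.mul_sum, Finset.sum_mul]
        rw [Finset.sum_comm]
        refine Finset.sum_eq_zero fun l hl => ?_
        rw [← mul_zero ((starRingEnd ℂ) (x j) * (starRingEnd ℂ) (R l j)), ← hker l hl,
          Finset.mul_sum]
        exact Finset.sum_congr rfl fun k _ => by ring
      exact Finset.sum_eq_zero fun j _ => h3 j
    conv_lhs => enter [2, j, 2, k]; rw [h1 j k]
    simp only [mul_add, add_mul, Finset.sum_add_distrib, h2, add_zero]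
    congr 1
    simp [hxi]
  have hdiag : (∑ l ∈ Finset.range i, (starRingEnd ℂ) (R l i) * R l i).re =
      ∑ l ∈ Finset.range i, ‖R l i‖ ^ 2 :=
    re_sum_conj_mul_self _ _
  have hq := hC x
  rw [hform, Complex.add_re, Complex.sub_re, hdiag, Finset.sum_range_succ, hxi, norm_one,
    one_pow] at hq
  set X := ∑ j ∈ Finset.range i, ‖x j‖ ^ 2
  have hX : 0 ≤ X := Finset.sum_nonneg fun _ _ => by positivity
  have hsq : ∑ l ∈ Finset.range i, (∑ j ∈ Finset.range (i + 1), ‖R l j‖ * ‖x j‖) ^ 2 ≤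
      2 * (β * X) + 2 * ∑ l ∈ Finset.range i, ‖R l i‖ ^ 2 := by
    calc _ ≤ ∑ l ∈ Finset.range i,
          (2 * ((∑ j ∈ Finset.range i, ‖R l j‖ ^ 2) * X) + 2 * ‖R l i‖ ^ 2) := by
          refine Finset.sum_le_sum fun l _ => ?_
          rw [Finset.sum_range_succ, hxi, norm_one, mul_one]
          have := Finset.sum_mul_sq_le_sq_mul_sq (Finset.range i) (fun j => ‖R l j‖)
            (fun j => ‖x j‖)
          nlinarith [sq_nonneg (∑ j ∈ Finset.range i, ‖R l j‖ * ‖x j‖ - ‖R l i‖)]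
      _ ≤ _ := by
          rw [Finset.sum_add_distrib, ← Finset.mul_sum, ← Finset.mul_sum, ← Finset.sum_mul]
          gcongr
  have hre := (Complex.re_le_norm _).trans (hbound.trans (mul_le_mul_of_nonneg_left hsq hG))
  have hβ0 : 0 ≤ β := hβ.trans' (Finset.sum_nonneg fun _ _ => Finset.sum_nonneg fun _ _ => by
    positivity)
  nlinarith [mul_le_mul_of_nonneg_right hν hX, mul_nonneg hG hβ0]

section Pivots

variable {δ : Op → ℝ} {C : ℕ → ℕ → ℂ} {K : ℕ} {g ν T : ℝ}

/-- The columns of the leading rows of the computed factor are bounded by the diagonal of `C`. -/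
lemma sum_norm_sq_cholRows_le
    (hG : ∀ i < K, ∀ j < K, ∀ p, SubGood (taskErr δ (.chol i j) p) (2 * i) g)
    (hg : 128 * g ≤ 1) (hC : IsHermArray C) {n j : ℕ} (hjn : j < n) (hn : n ≤ K)
    (hp : ∀ k < n, 0 < cholPivot δ C (cholRows δ C K) k) :
    ∑ l ∈ Finset.range n, ‖cholRows δ C K l j‖ ^ 2 ≤ 2 * (C j j).re := by
  have h := norm_sub_cholRows_le_of_lt hG (by linarith) hC (Or.inl hjn) hn (by omega) (by omega)
    (j := j) hp
  have hdiag : (∑ l ∈ Finset.range n,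
      (starRingEnd ℂ) (cholRows δ C K l j) * cholRows δ C K l j).re =
      ∑ l ∈ Finset.range n, ‖cholRows δ C K l j‖ ^ 2 :=
    re_sum_conj_mul_self _ _
  have h1 := (abs_le.1 ((Complex.abs_re_le_norm _).trans h)).1
  rw [Complex.sub_re, hdiag] at h1
  simp only [← sq] at h1
  have h0 : 0 ≤ ∑ l ∈ Finset.range n, ‖cholRows δ C K l j‖ ^ 2 :=
    Finset.sum_nonneg fun _ _ => by positivity
  nlinarith

/-- If the form of `C` is bounded below by `ν`, and `g` times the trace is small relative to `ν`,
the computed pivots are positive. -/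
lemma cholPivot_pos
    (hG : ∀ i < K, ∀ j < K, ∀ p, SubGood (taskErr δ (.chol i j) p) (2 * i) g)
    (hg : 128 * g ≤ 1) (hg0 : 0 ≤ g) (hC : IsHermArray C)
    (hpos : ∀ x : ℕ → ℂ, ν * ∑ j ∈ Finset.range K, ‖x j‖ ^ 2 ≤
      (∑ j ∈ Finset.range K, ∑ k ∈ Finset.range K, (starRingEnd ℂ) (x j) * C j k * x k).re)
    (hν0 : 0 < ν) (hT : ∑ i ∈ Finset.range K, (C i i).re ≤ T) (hν : 400 * g * T ≤ ν) :
    ∀ i < K, 0 < cholPivot δ C (cholRows δ C K) i := by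
  have hloc : ∀ i < K, ∀ x : ℕ → ℂ, ν * ∑ j ∈ Finset.range (i + 1), ‖x j‖ ^ 2 ≤
      (∑ j ∈ Finset.range (i + 1), ∑ k ∈ Finset.range (i + 1),
        (starRingEnd ℂ) (x j) * C j k * x k).re := by
    intro i hi x
    have hsub : Finset.range (i + 1) ⊆ Finset.range K := Finset.range_mono hi
    have h := hpos fun j => if j ∈ Finset.range (i + 1) then x j else 0
    rw [← Finset.sum_subset hsub (fun l _ hl' => by simp only [if_neg hl']; simp),
      ← Finset.sum_subset hsub (fun l _ hl' => by simp only [if_neg hl']; simp)] at h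
    convert h using 2
    · exact Finset.sum_congr rfl fun j hj => by rw [if_pos hj]
    · refine Finset.sum_congr rfl fun j hj => ?_
      rw [← Finset.sum_subset hsub (fun l _ hl' => by simp only [if_neg hl']; simp)]
      exact Finset.sum_congr rfl fun k hk => by rw [if_pos hj, if_pos hk]
  have hdiag0 : ∀ i < K, 0 ≤ (C i i).re := by
    intro i hi
    have h := hpos (Pi.single i 1)
    have hz : ∀ j, j ≠ i → (Pi.single i 1 : ℕ → ℂ) j = 0 := fun j hj => by simp [hj]
    rw [Finset.sum_eq_single i (fun j _ hj => by
        rw [hz j hj]; simp) (by simp [hi]),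
      Finset.sum_eq_single i (fun j _ hj => by simp [hz j hj]) (by simp [hi]),
      Finset.sum_eq_single i (fun j _ hj => by simp [hz j hj]) (by simp [hi])] at h
    simp at h
    linarith
  intro i
  induction i using Nat.strong_induction_on with
  | _ i ih =>
  intro hi
  have hp : ∀ k < i, 0 < cholPivot δ C (cholRows δ C K) k := fun k hk => ih k hk (hk.trans hi)
  have hTi : ∑ j ∈ Finset.range (i + 1), (C j j).re ≤ T :=
    hT.trans' (Finset.sum_le_sum_of_subset_of_nonneg (Finset.range_mono hi)
      fun j hj _ => hdiag0 j (Finset.mem_range.1 hj))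
  rw [Finset.sum_range_succ] at hTi
  have hs0 : 0 ≤ ∑ j ∈ Finset.range i, (C j j).re :=
    Finset.sum_nonneg fun j hj => hdiag0 j ((Finset.mem_range.1 hj).trans hi)
  have hβ : ∑ l ∈ Finset.range i, ∑ j ∈ Finset.range i, ‖cholRows δ C K l j‖ ^ 2 ≤ 2 * T := by
    rw [Finset.sum_comm]
    calc _ ≤ ∑ j ∈ Finset.range i, 2 * (C j j).re := Finset.sum_le_sum fun j hj =>
          sum_norm_sq_cholRows_le hG hg hC (Finset.mem_range.1 hj) hi.le hp
      _ ≤ _ := by rw [← Finset.mul_sum]; linarith [hdiag0 i hi]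
  have hT0 : 0 ≤ T := by linarith [hdiag0 i hi]
  have hlow := le_diag_of_posDef (C := C) (R := cholRows δ C K) (i := i) (ν := ν) (G := 32 * g)
    (β := 2 * T) (by positivity) (hloc i hi)
    (fun j hj k hk hjk => norm_sub_cholRows_le_of_lt hG (by linarith) hC hjk hi.le (by omega)
      (by omega) hp)
    (fun l hl j hj => cholRows_apply_of_lt (hl.trans hi) hj)
    (fun l hl => by
      rw [cholRows_apply_self (hl.trans hi)]
      exact Complex.ofReal_ne_zero.2 (cholDiag_pos (hG l (hl.trans hi) l (hl.trans hi) .re)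
        (by linarith) (hp l hl)).ne')
    hβ (by nlinarith [mul_nonneg hg0 hT0])
  have h1 := abs_flSub_sub_le (hG i hi i hi .re) (C i i).re
      (leftReal i (fun k => cholRows δ C K k i) .re) (rightReal i (fun k => cholRows δ C K k i))
  have h2 := sum_abs_leftReal_le i (fun k => cholRows δ C K k i) (fun k => cholRows δ C K k i) .re
  have hdiag : (∑ l ∈ Finset.range i,
      (starRingEnd ℂ) (cholRows δ C K l i) * cholRows δ C K l i).re =
      ∑ l ∈ Finset.range i, ‖cholRows δ C K l i‖ ^ 2 :=
    re_sum_conj_mul_self _ _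
  rw [sum_leftReal_re, hdiag, abs_of_nonneg (hdiag0 i hi)] at h1
  simp only [← sq] at h2
  change |cholPivot δ C (cholRows δ C K) i - _| ≤ _ at h1
  have h3 := (abs_le.1 h1).1
  have h4 := mul_le_mul_of_nonneg_left h2 hg0
  set s := ∑ l ∈ Finset.range i, ‖cholRows δ C K l i‖ ^ 2
  have hsn : 0 ≤ s := Finset.sum_nonneg fun _ _ => by positivity
  have hcT : (C i i).re ≤ T := by linarith
  have hgT := mul_le_mul_of_nonneg_left hcT hg0
  have hs2 : s ≤ 2 * (C i i).re := by nlinarith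
  have hgs := mul_le_mul_of_nonneg_left hs2 hg0
  linarith

end Pivots

/-! ### Euclidean, spectral and Frobenius norms -/

lemma vecNorm_nonneg {n : ℕ} (v : Fin n → ℂ) : 0 ≤ vecNorm v := norm_nonneg _

lemma vecNorm_sq {n : ℕ} (v : Fin n → ℂ) : vecNorm v ^ 2 = ∑ i, ‖v i‖ ^ 2 :=
  EuclideanSpace.norm_sq_eq _

lemma vecNorm_add_le {n : ℕ} (v w : Fin n → ℂ) : vecNorm (v + w) ≤ vecNorm v + vecNorm w :=
  norm_add_le (WithLp.toLp 2 v) (WithLp.toLp 2 w)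

lemma vecNorm_sub_rev {n : ℕ} (v w : Fin n → ℂ) : vecNorm (v - w) = vecNorm (w - v) :=
  norm_sub_rev (WithLp.toLp 2 v) (WithLp.toLp 2 w)

lemma specNorm_nonneg {m n : ℕ} (A : Matrix (Fin m) (Fin n) ℂ) : 0 ≤ specNorm A :=
  norm_nonneg (Matrix.toEuclideanLin (𝕜 := ℂ) A).toContinuousLinearMap

section Norms
open scoped Matrix.Norms.L2Operator

lemma vecNorm_mulVec_le {m n : ℕ} (A : Matrix (Fin m) (Fin n) ℂ) (v : Fin n → ℂ) :
    vecNorm (A *ᵥ v) ≤ specNorm A * vecNorm v :=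
  Matrix.l2_opNorm_mulVec A (WithLp.toLp 2 v)

lemma specNorm_conjTranspose_mul_self {m n : ℕ} (A : Matrix (Fin m) (Fin n) ℂ) :
    specNorm (Aᴴ * A) = specNorm A ^ 2 := by
  rw [sq]
  exact Matrix.l2_opNorm_conjTranspose_mul_self A

lemma specNorm_conjTranspose {m n : ℕ} (A : Matrix (Fin m) (Fin n) ℂ) :
    specNorm Aᴴ = specNorm A :=
  Matrix.l2_opNorm_conjTranspose A

end Norms

/-- The Frobenius norm of a complex matrix. -/
noncomputable def frobNorm {m n : ℕ} (B : Matrix (Fin m) (Fin n) ℂ) : ℝ :=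
  √(∑ i, ∑ j, ‖B i j‖ ^ 2)

lemma frobNorm_nonneg {m n : ℕ} (B : Matrix (Fin m) (Fin n) ℂ) : 0 ≤ frobNorm B :=
  Real.sqrt_nonneg _

lemma frobNorm_sq {m n : ℕ} (B : Matrix (Fin m) (Fin n) ℂ) :
    frobNorm B ^ 2 = ∑ i, ∑ j, ‖B i j‖ ^ 2 :=
  Real.sq_sqrt (Finset.sum_nonneg fun _ _ => Finset.sum_nonneg fun _ _ => by positivity)

lemma frobNorm_conjTranspose {m n : ℕ} (B : Matrix (Fin m) (Fin n) ℂ) :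
    frobNorm Bᴴ = frobNorm B := by
  rw [frobNorm, frobNorm, Finset.sum_comm]
  simp

lemma frobNorm_sq_le {m n : ℕ} (B : Matrix (Fin m) (Fin n) ℂ) :
    frobNorm B ^ 2 ≤ n * specNorm B ^ 2 := by
  rw [frobNorm_sq, Finset.sum_comm]
  have h : ∀ j, ∑ i, ‖B i j‖ ^ 2 ≤ specNorm B ^ 2 := by
    intro j
    have h1 := vecNorm_mulVec_le B (Pi.single j 1)
    have h2 : vecNorm (Pi.single j 1 : Fin n → ℂ) = 1 := by
      simp [vecNorm]
    rw [h2, mul_one, Matrix.mulVec_single_one] at h1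
    have h3 := pow_le_pow_left₀ (vecNorm_nonneg _) h1 2
    rw [vecNorm_sq] at h3
    simpa using h3
  calc _ ≤ ∑ _j : Fin n, specNorm B ^ 2 := Finset.sum_le_sum fun j _ => h j
    _ = _ := by simp

/-- A vector dominated entrywise by `g |B| |v|`. -/
lemma vecNorm_le_of_norm_le {m n : ℕ} {B : Matrix (Fin m) (Fin n) ℂ} {v : Fin n → ℂ}
    {f : Fin m → ℂ} {g : ℝ} (hg : 0 ≤ g) (h : ∀ i, ‖f i‖ ≤ g * ∑ j, ‖B i j‖ * ‖v j‖) :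
    vecNorm f ≤ g * frobNorm B * vecNorm v := by
  refine (pow_le_pow_iff_left₀ (vecNorm_nonneg f) ?_ two_ne_zero).1 ?_
  · exact mul_nonneg (mul_nonneg hg (frobNorm_nonneg B)) (vecNorm_nonneg v)
  rw [vecNorm_sq, mul_pow, mul_pow, frobNorm_sq, vecNorm_sq, mul_assoc, Finset.sum_mul,
    Finset.mul_sum]
  refine Finset.sum_le_sum fun i _ => (pow_le_pow_left₀ (norm_nonneg _) (h i) 2).trans ?_
  rw [mul_pow]
  exact mul_le_mul_of_nonneg_left (Finset.sum_mul_sq_le_sq_mul_sq _ _ _) (by positivity)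

lemma vecNorm_mulVec_le_frobNorm {m n : ℕ} (B : Matrix (Fin m) (Fin n) ℂ) (v : Fin n → ℂ) :
    vecNorm (B *ᵥ v) ≤ frobNorm B * vecNorm v := by
  have := vecNorm_le_of_norm_le (B := B) (v := v) (f := B *ᵥ v) zero_le_one (fun i => by
    rw [one_mul]
    exact (norm_sum_le _ _).trans_eq (Finset.sum_congr rfl fun j _ => norm_mul (B i j) (v j)))
  rwa [one_mul] at this

/-- A matrix dominated entrywise by `g |B|ᵀ |B|`. -/
lemma vecNorm_mulVec_le_of_norm_le {m n : ℕ} {B : Matrix (Fin m) (Fin n) ℂ}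
    {E : Matrix (Fin n) (Fin n) ℂ} {g : ℝ} (hg : 0 ≤ g)
    (hE : ∀ i k, ‖E i k‖ ≤ g * ∑ l, ‖B l i‖ * ‖B l k‖) (v : Fin n → ℂ) :
    vecNorm (E *ᵥ v) ≤ g * frobNorm B ^ 2 * vecNorm v := by
  let w : Fin m → ℂ := fun l => ((∑ k, ‖B l k‖ * ‖v k‖ : ℝ) : ℂ)
  have hwn : ∀ l, ‖w l‖ = ∑ k, ‖B l k‖ * ‖v k‖ := fun l => by
    rw [Complex.norm_real, Real.norm_of_nonneg (Finset.sum_nonneg fun _ _ => by positivity)]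
  have hw : vecNorm w ≤ frobNorm B * vecNorm v := by
    have := vecNorm_le_of_norm_le (B := B) (v := v) (f := w) zero_le_one
      (fun l => by rw [hwn, one_mul])
    rwa [one_mul] at this
  have h1 : vecNorm (E *ᵥ v) ≤ g * frobNorm Bᴴ * vecNorm w := by
    refine vecNorm_le_of_norm_le hg fun i => ?_
    calc ‖∑ k, E i k * v k‖ ≤ ∑ k, (g * ∑ l, ‖B l i‖ * ‖B l k‖) * ‖v k‖ := by
          refine (norm_sum_le _ _).trans (Finset.sum_le_sum fun k _ => ?_)
          rw [norm_mul]
          exact mul_le_mul_of_nonneg_right (hE i k) (norm_nonneg _)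
      _ = _ := by
          simp only [hwn, Finset.mul_sum, Finset.sum_mul, Matrix.conjTranspose_apply, norm_star]
          rw [Finset.sum_comm]
          exact Finset.sum_congr rfl fun _ _ => Finset.sum_congr rfl fun _ _ => by ring
  rw [frobNorm_conjTranspose] at h1
  refine h1.trans ?_
  rw [sq, ← mul_assoc, mul_assoc _ (frobNorm B) (vecNorm v)]
  exact mul_le_mul_of_nonneg_left hw (mul_nonneg hg (frobNorm_nonneg B))

/-! ### Zero forcing in exact arithmetic -/

open scoped ComplexOrder in
lemma isUnit_det_conjTranspose_mul_self {M K : ℕ} {H : Matrix (Fin M) (Fin K) ℂ}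
    (hH : H.rank = K) : IsUnit (Hᴴ * H).det := by
  rw [← Matrix.isUnit_iff_isUnit_det, ← Matrix.mulVec_surjective_iff_isUnit]
  have htop : LinearMap.range (Hᴴ * H).mulVecLin = ⊤ := by
    refine Submodule.eq_top_of_finrank_eq ?_
    rw [← Matrix.rank, Matrix.rank_conjTranspose_mul_self, hH, Module.finrank_fin_fun]
  exact LinearMap.range_eq_top.1 htop

section Exact

variable {M K : ℕ} {H : Matrix (Fin M) (Fin K) ℂ}

lemma conjTranspose_zfMatrix (H : Matrix (Fin M) (Fin K) ℂ) :
    (zfMatrix H)ᴴ = (Hᴴ * H)⁻¹ * Hᴴ := by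
  rw [zfMatrix, Matrix.conjTranspose_mul, Matrix.conjTranspose_nonsing_inv,
    Matrix.conjTranspose_mul, Matrix.conjTranspose_conjTranspose]

lemma conjTranspose_zfMatrix_mul_self (hH : IsUnit (Hᴴ * H).det) : (zfMatrix H)ᴴ * H = 1 := by
  rw [conjTranspose_zfMatrix, Matrix.mul_assoc, Matrix.nonsing_inv_mul _ hH]

lemma gram_mulVec_zf (hH : IsUnit (Hᴴ * H).det) (z : Fin M → ℂ) :
    (Hᴴ * H) *ᵥ ((zfMatrix H)ᴴ *ᵥ z) = Hᴴ *ᵥ z := by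
  rw [conjTranspose_zfMatrix, Matrix.mulVec_mulVec, ← Matrix.mul_assoc,
    Matrix.mul_nonsing_inv _ hH, Matrix.one_mul]

lemma specNorm_zfMatrix_sq (hH : IsUnit (Hᴴ * H).det) :
    specNorm (zfMatrix H) ^ 2 = specNorm (Hᴴ * H)⁻¹ := by
  rw [← specNorm_conjTranspose_mul_self]
  congr 1
  rw [zfMatrix, ← zfMatrix, conjTranspose_zfMatrix, zfMatrix, Matrix.mul_assoc,
    ← Matrix.mul_assoc Hᴴ, Matrix.mul_nonsing_inv _ hH, Matrix.mul_one]

lemma vecNorm_sq_le_of_isUnit (hH : IsUnit (Hᴴ * H).det) (v : Fin K → ℂ) :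
    vecNorm v ^ 2 ≤ specNorm (Hᴴ * H)⁻¹ * vecNorm (H *ᵥ v) ^ 2 := by
  have h := vecNorm_mulVec_le (zfMatrix H)ᴴ (H *ᵥ v)
  rw [Matrix.mulVec_mulVec, conjTranspose_zfMatrix_mul_self hH, Matrix.one_mulVec,
    specNorm_conjTranspose] at h
  rw [← specNorm_zfMatrix_sq hH, ← mul_pow]
  exact pow_le_pow_left₀ (vecNorm_nonneg _) h 2

lemma specNorm_inv_pos (hH : IsUnit (Hᴴ * H).det) (hK : 1 ≤ K) :
    0 < specNorm (Hᴴ * H)⁻¹ := by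
  refine (specNorm_nonneg _).lt_of_ne fun h0 => ?_
  have h := vecNorm_sq_le_of_isUnit hH (fun _ => 1)
  rw [← h0, zero_mul, vecNorm_sq] at h
  simp at h
  omega

end Exact

/-! ### Rounding errors in the normal equations -/

section Gram

variable {M K : ℕ} {H : Matrix (Fin M) (Fin K) ℂ} {z : Fin M → ℂ} {δ : Op → ℝ} {g : ℝ}

lemma entry_apply (H : Matrix (Fin M) (Fin K) ℂ) (m : Fin M) (k : Fin K) :
    entry H m k = H m k := by
  simp [entry]

lemma ventry_apply (z : Fin M → ℂ) (m : Fin M) : ventry z m = z m := by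
  simp [ventry]

lemma isHermArray_compGram (δ : Op → ℝ) (H : Matrix (Fin M) (Fin K) ℂ) :
    IsHermArray (compGram δ H) := by
  intro i j
  rcases lt_trichotomy i j with h | rfl | h
  · simp [compGram, h, h.not_gt, h.ne']
  · simp [compGram]
  · simp [compGram, h, h.not_gt, h.ne']

lemma norm_compRhs_sub_le {i : ℕ} (h : ∀ p, DotGood (taskErr δ (.rhs i) p) (2 * M) g)
    (hg : 0 ≤ g) (H : Matrix (Fin M) (Fin K) ℂ) (z : Fin M → ℂ) :
    ‖compRhs δ H z i - ∑ m ∈ Finset.range M, (starRingEnd ℂ) (entry H m i) * ventry z m‖ ≤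
      2 * g * ∑ m ∈ Finset.range M, ‖entry H m i‖ * ‖ventry z m‖ :=
  norm_flDotC_sub_le h hg _ _

lemma norm_compGram_sub_le
    (h : ∀ i < K, ∀ j < K, ∀ p, DotGood (taskErr δ (.gram i j) p) (2 * M) g)
    (hg : 0 ≤ g) (H : Matrix (Fin M) (Fin K) ℂ) {i j : ℕ} (hi : i < K) (hj : j < K) :
    ‖compGram δ H i j - ∑ m ∈ Finset.range M, (starRingEnd ℂ) (entry H m i) * entry H m j‖ ≤
      2 * g * ∑ m ∈ Finset.range M, ‖entry H m i‖ * ‖entry H m j‖ := by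
  rcases lt_trichotomy i j with hij | rfl | hij
  · rw [compGram, if_pos hij]
    exact norm_flDotC_sub_le (h i hi j hj) hg _ _
  · rw [compGram, if_neg (lt_irrefl i), if_pos rfl]
    have h1 := norm_flDotC_sub_le (h i hi i hj) hg (fun m => entry H m i) (fun m => entry H m i)
    refine le_trans ?_ h1
    have hs : ∑ l ∈ Finset.range M, (starRingEnd ℂ) (entry H l i) * entry H l i =
        ((∑ l ∈ Finset.range M, (starRingEnd ℂ) (entry H l i) * entry H l i).re : ℂ) :=
      sum_conj_mul_self_eq_ofReal_re _ _
    rw [hs, ← Complex.ofReal_sub, ← Complex.sub_re, Complex.norm_real, ← hs]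
    exact Complex.abs_re_le_norm _
  · have h1 := norm_flDotC_sub_le (h j hj i hi) hg (fun m => entry H m j) (fun m => entry H m i)
    rw [isHermArray_compGram δ H j i, compGram, if_pos hij, compGramEntry, ← Complex.norm_conj,
      map_sub, map_sum]
    simp only [map_mul, Complex.conj_conj]
    simpa only [mul_comm] using h1

lemma sum_re_compGram_le
    (h : ∀ i < K, ∀ j < K, ∀ p, DotGood (taskErr δ (.gram i j) p) (2 * M) g)
    (hg : 0 ≤ g) (hg' : 2 * g ≤ 1) (H : Matrix (Fin M) (Fin K) ℂ) :
    ∑ i ∈ Finset.range K, (compGram δ H i i).re ≤ 2 * frobNorm H ^ 2 := by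
  have h1 : ∀ i ∈ Finset.range K, (compGram δ H i i).re ≤
      2 * ∑ m ∈ Finset.range M, ‖entry H m i‖ ^ 2 := by
    intro i hi
    have h2 := norm_compGram_sub_le h hg H (Finset.mem_range.1 hi) (Finset.mem_range.1 hi)
    have h3 := (abs_le.1 ((Complex.abs_re_le_norm _).trans h2)).2
    have hdiag : (∑ m ∈ Finset.range M, (starRingEnd ℂ) (entry H m i) * entry H m i).re =
        ∑ m ∈ Finset.range M, ‖entry H m i‖ ^ 2 :=
      re_sum_conj_mul_self _ _
    rw [Complex.sub_re, hdiag] at h3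
    simp only [← sq] at h3
    have h0 : 0 ≤ ∑ m ∈ Finset.range M, ‖entry H m i‖ ^ 2 :=
      Finset.sum_nonneg fun _ _ => by positivity
    nlinarith
  refine (Finset.sum_le_sum h1).trans_eq ?_
  rw [← Finset.mul_sum, frobNorm_sq, Finset.sum_comm, Finset.sum_range]
  congr 1
  refine Finset.sum_congr rfl fun m _ => ?_
  rw [Finset.sum_range]
  simp only [entry_apply]

/-- The computed Gram matrix inherits a lower bound for its form from the exact one. -/
lemma compGram_form_ge
    (h : ∀ i < K, ∀ j < K, ∀ p, DotGood (taskErr δ (.gram i j) p) (2 * M) g)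
    (hg : 0 ≤ g) (hK : 1 ≤ K) (hH : IsUnit (Hᴴ * H).det)
    (hsmall : 4 * g * frobNorm H ^ 2 * specNorm (Hᴴ * H)⁻¹ ≤ 1) (x : ℕ → ℂ) :
    1 / (2 * specNorm (Hᴴ * H)⁻¹) * ∑ j ∈ Finset.range K, ‖x j‖ ^ 2 ≤
      (∑ j ∈ Finset.range K, ∑ k ∈ Finset.range K,
        (starRingEnd ℂ) (x j) * compGram δ H j k * x k).re := by
  let y : Fin K → ℂ := fun k => x k
  let S : ℕ → ℕ → ℂ := fun j k =>
    ∑ m ∈ Finset.range M, (starRingEnd ℂ) (entry H m j) * entry H m k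
  have hy : ∑ j ∈ Finset.range K, ‖x j‖ ^ 2 = vecNorm y ^ 2 := by
    rw [vecNorm_sq, Finset.sum_range]
  have hHy : ∀ m : Fin M, ∑ k ∈ Finset.range K, entry H m k * x k = (H *ᵥ y) m := by
    intro m
    rw [Finset.sum_range]
    simp only [entry_apply]
    rfl
  have hS : ∑ j ∈ Finset.range K, ∑ k ∈ Finset.range K, (starRingEnd ℂ) (x j) * S j k * x k =
      ((vecNorm (H *ᵥ y) ^ 2 : ℝ) : ℂ) := by
    have h1 : ∑ j ∈ Finset.range K, ∑ k ∈ Finset.range K, (starRingEnd ℂ) (x j) * S j k * x k =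
        ∑ m ∈ Finset.range M, (starRingEnd ℂ) (∑ k ∈ Finset.range K, entry H m k * x k) *
          ∑ k ∈ Finset.range K, entry H m k * x k := by
      simp only [S, map_sum, map_mul, Finset.mul_sum, Finset.sum_mul]
      symm
      rw [Finset.sum_comm_cycle, Finset.sum_comm_cycle, Finset.sum_comm]
      exact Finset.sum_congr rfl fun j _ => Finset.sum_congr rfl fun k _ =>
        Finset.sum_congr rfl fun l _ => by ring
    rw [h1, Finset.sum_range, vecNorm_sq, Complex.ofReal_sum]
    refine Finset.sum_congr rfl fun m _ => ?_
    rw [hHy, mul_comm, Complex.mul_conj, Complex.normSq_eq_norm_sq]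
  have hE := norm_sum_conj_mul_le (s := Finset.range K) (t := Finset.range M)
    (E := fun j k => compGram δ H j k - S j k) (B := fun m k => entry H m k) (g := 2 * g) x
    (fun j hj k hk => norm_compGram_sub_le h hg H (Finset.mem_range.1 hj) (Finset.mem_range.1 hk))
  have hF : ∑ m ∈ Finset.range M, (∑ j ∈ Finset.range K, ‖entry H m j‖ * ‖x j‖) ^ 2 ≤
      frobNorm H ^ 2 * vecNorm y ^ 2 := by
    rw [frobNorm_sq, vecNorm_sq, Finset.sum_mul, Finset.sum_range]
    refine Finset.sum_le_sum fun m _ => ?_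
    rw [Finset.sum_range]
    simp only [entry_apply]
    exact Finset.sum_mul_sq_le_sq_mul_sq _ _ _
  have hsplit : ∑ j ∈ Finset.range K, ∑ k ∈ Finset.range K,
      (starRingEnd ℂ) (x j) * compGram δ H j k * x k =
      ((vecNorm (H *ᵥ y) ^ 2 : ℝ) : ℂ) + ∑ j ∈ Finset.range K, ∑ k ∈ Finset.range K,
        (starRingEnd ℂ) (x j) * (compGram δ H j k - S j k) * x k := by
    rw [← hS, ← Finset.sum_add_distrib]
    refine Finset.sum_congr rfl fun j _ => ?_
    rw [← Finset.sum_add_distrib]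
    exact Finset.sum_congr rfl fun k _ => by ring
  rw [hsplit, Complex.add_re, Complex.ofReal_re, hy]
  have hI := specNorm_inv_pos hH hK
  have h1 := vecNorm_sq_le_of_isUnit hH y
  have h2 := (abs_le.1 ((Complex.abs_re_le_norm _).trans
    (hE.trans (mul_le_mul_of_nonneg_left hF (by positivity))))).1
  set I := specNorm (Hᴴ * H)⁻¹
  have h3 : 2 * g * (frobNorm H ^ 2 * vecNorm y ^ 2) ≤ vecNorm y ^ 2 / (2 * I) := by
    rw [le_div_iff₀ (by positivity)]
    nlinarith [sq_nonneg (vecNorm y)]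
  have h4 : vecNorm y ^ 2 / I ≤ vecNorm (H *ᵥ y) ^ 2 := by
    rw [div_le_iff₀ hI]
    linarith
  have h5 : 1 / (2 * I) * vecNorm y ^ 2 = vecNorm y ^ 2 / I - vecNorm y ^ 2 / (2 * I) := by
    field_simp
    ring
  rw [h5]
  linarith

end Gram

/-! ### Forward error of the method for one realization of the rounding errors -/

/-- The rounding errors of the method have accumulated factors close to `1`: up to `g₁` in the
inner products of length `2M`, up to `g₂` in the factorization and the substitutions. -/
structure ErrorsBounded (δ : Op → ℝ) (M K : ℕ) (g₁ g₂ : ℝ) : Prop where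
  rhs : ∀ i < K, ∀ p, DotGood (taskErr δ (.rhs i) p) (2 * M) g₁
  gram : ∀ i < K, ∀ j < K, ∀ p, DotGood (taskErr δ (.gram i j) p) (2 * M) g₁
  chol : ∀ i < K, ∀ j < K, ∀ p, SubGood (taskErr δ (.chol i j) p) (2 * i) g₂
  fwd : ∀ i < K, ∀ p, SubGood (taskErr δ (.fwd i) p) (2 * i) g₂
  bwd : ∀ i < K, ∀ p, SubGood (taskErr δ (.bwd i) p) (2 * (K - 1 - i)) g₂

/-- Residual of a vector `r` obtained by approximately solving `Rᴴ q = c`, `R r = q`, as an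
approximate solution of the system with a matrix close to `Rᴴ R`. -/
lemma vecNorm_residual_le {K : ℕ} {R C : Matrix (Fin K) (Fin K) ℂ} {c q r : Fin K → ℂ} {G : ℝ}
    (hG : 0 ≤ G) (hG1 : G ≤ 1)
    (hC : ∀ i j, ‖C i j - (Rᴴ * R) i j‖ ≤ G * ∑ l, ‖R l i‖ * ‖R l j‖)
    (hc : ∀ i, ‖c i - (Rᴴ *ᵥ q) i‖ ≤ G * ∑ l, ‖R l i‖ * ‖q l‖)
    (hq : ∀ i, ‖q i - (R *ᵥ r) i‖ ≤ G * ∑ l, ‖R i l‖ * ‖r l‖) :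
    vecNorm (c - C *ᵥ r) ≤ 4 * G * frobNorm R ^ 2 * vecNorm r := by
  have h1 : vecNorm (c - Rᴴ *ᵥ q) ≤ G * frobNorm R * vecNorm q := by
    have := vecNorm_le_of_norm_le (B := Rᴴ) (v := q) (f := c - Rᴴ *ᵥ q) hG
      (fun i => by simpa using hc i)
    rwa [frobNorm_conjTranspose] at this
  have h2 : vecNorm (q - R *ᵥ r) ≤ G * frobNorm R * vecNorm r :=
    vecNorm_le_of_norm_le hG (fun i => by simpa using hq i)
  have h3 : vecNorm ((Rᴴ * R - C) *ᵥ r) ≤ G * frobNorm R ^ 2 * vecNorm r :=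
    vecNorm_mulVec_le_of_norm_le hG (fun i k => by
      rw [Matrix.sub_apply, norm_sub_rev]
      exact hC i k) r
  have h4 : vecNorm (Rᴴ *ᵥ (q - R *ᵥ r)) ≤ frobNorm R * vecNorm (q - R *ᵥ r) := by
    have := vecNorm_mulVec_le_frobNorm Rᴴ (q - R *ᵥ r)
    rwa [frobNorm_conjTranspose] at this
  have h5 : vecNorm q ≤ vecNorm (q - R *ᵥ r) + frobNorm R * vecNorm r := by
    calc vecNorm q = vecNorm ((q - R *ᵥ r) + R *ᵥ r) := by rw [sub_add_cancel]
      _ ≤ _ := (vecNorm_add_le _ _).trans (add_le_add_right (vecNorm_mulVec_le_frobNorm R r) _)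
  have hsplit : c - C *ᵥ r =
      (c - Rᴴ *ᵥ q) + Rᴴ *ᵥ (q - R *ᵥ r) + (Rᴴ * R - C) *ᵥ r := by
    rw [Matrix.mulVec_sub, Matrix.sub_mulVec, Matrix.mulVec_mulVec]
    abel
  have h6 := (vecNorm_add_le ((c - Rᴴ *ᵥ q) + Rᴴ *ᵥ (q - R *ᵥ r)) ((Rᴴ * R - C) *ᵥ r)).trans
    (add_le_add_left (vecNorm_add_le _ _) _)
  rw [hsplit]
  refine h6.trans ?_
  have hF := frobNorm_nonneg R
  have hr := vecNorm_nonneg r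
  have hFr : 0 ≤ frobNorm R * vecNorm r := mul_nonneg hF hr
  have h7 : vecNorm q ≤ 2 * (frobNorm R * vecNorm r) := by nlinarith
  have h8 := mul_le_mul_of_nonneg_left h7 (mul_nonneg hG hF)
  have h9 := mul_le_mul_of_nonneg_left h2 hF
  nlinarith

section Solve

variable {M K : ℕ} {H : Matrix (Fin M) (Fin K) ℂ} {z : Fin M → ℂ} {δ : Op → ℝ} {g₁ g₂ : ℝ}

/-- The factorization runs to completion. -/
lemma neRuns_of_errorsBounded (h : ErrorsBounded δ M K g₁ g₂) (hK : 1 ≤ K)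
    (hH : IsUnit (Hᴴ * H).det) (h₁ : 0 ≤ g₁) (h₂ : 0 ≤ g₂) (hg₁ : 2 * g₁ ≤ 1)
    (hg₂ : 128 * g₂ ≤ 1) (hκ₁ : 8 * g₁ * K * cond2 (Hᴴ * H) ≤ 1)
    (hκ₂ : 4096 * g₂ * K * cond2 (Hᴴ * H) ≤ 1) : NERuns δ H := by
  have hI := specNorm_inv_pos hH hK
  have hF := frobNorm_sq_le H
  rw [← specNorm_conjTranspose_mul_self] at hF
  rw [cond2] at hκ₁ hκ₂
  have hN := mul_le_mul_of_nonneg_right hF hI.le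
  refine cholPivot_pos (ν := 1 / (2 * specNorm (Hᴴ * H)⁻¹)) h.chol hg₂ h₂
    (isHermArray_compGram δ H) ?_ (by positivity) (sum_re_compGram_le h.gram h₁ hg₁ H) ?_
  · refine compGram_form_ge h.gram h₁ hK hH ?_
    have := mul_le_mul_of_nonneg_left hN h₁
    linarith
  · rw [le_div_iff₀ (by positivity)]
    have := mul_le_mul_of_nonneg_left hN h₂
    have : 0 ≤ g₂ * (K * specNorm (Hᴴ * H) * specNorm (Hᴴ * H)⁻¹) :=
      mul_nonneg h₂ (mul_nonneg (mul_nonneg (Nat.cast_nonneg K) (specNorm_nonneg _)) hI.le)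
    linarith

/-- Forward error of the method: rounding errors in the right-hand side enter through the
stability factor `τ`, all others through relative perturbations of the Gram matrix. -/
lemma vecNorm_neSolve_sub_le (h : ErrorsBounded δ M K g₁ g₂) (hK : 1 ≤ K)
    (hH : IsUnit (Hᴴ * H).det) (h₁ : 0 ≤ g₁) (h₂ : 0 ≤ g₂) (hg₁ : 2 * g₁ ≤ 1)
    (hg₂ : 128 * g₂ ≤ 1) (hκ₁ : 8 * g₁ * K * cond2 (Hᴴ * H) ≤ 1)
    (hκ₂ : 4096 * g₂ * K * cond2 (Hᴴ * H) ≤ 1) {τ : ℝ} (hτ : 0 ≤ τ)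
    (hstab : specNorm H * vecNorm z ≤ τ * vecNorm (Hᴴ *ᵥ z)) :
    vecNorm (neSolve δ H z - (zfMatrix H)ᴴ *ᵥ z) ≤
      (4 * g₁ * √(K : ℝ) * τ + 1024 * g₂ * K + 4 * g₁ * K) * cond2 (Hᴴ * H) *
        vecNorm ((zfMatrix H)ᴴ *ᵥ z) := by
  have hruns := neRuns_of_errorsBounded h hK hH h₁ h₂ hg₁ hg₂ hκ₁ hκ₂
  have hI := specNorm_inv_pos hH hK
  have hF := frobNorm_sq_le H
  have hF' := hF
  rw [← specNorm_conjTranspose_mul_self] at hF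
  let R : Matrix (Fin K) (Fin K) ℂ := Matrix.of fun i j => neFactor δ H i j
  let C : Matrix (Fin K) (Fin K) ℂ := Matrix.of fun i j => compGram δ H i j
  let c : Fin K → ℂ := fun i => compRhs δ H z i
  let q : Fin K → ℂ := fun i => fwdSubst δ (neFactor δ H) (compRhs δ H z) K i
  set r := neSolve δ H z
  set r₀ := (zfMatrix H)ᴴ *ᵥ z with hr₀
  have htri : ∀ i < K, ∀ j < i, neFactor δ H i j = 0 := fun i hi j hj =>
    cholRows_apply_of_lt hi hj
  have hdiag : ∀ i < K, neFactor δ H i i = cholDiag δ (compGram δ H) (neFactor δ H) i :=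
    fun i hi => cholRows_apply_self hi
  have hd : ∀ i < K, 0 < cholDiag δ (compGram δ H) (neFactor δ H) i := fun i hi =>
    cholDiag_pos (h.chol i hi i hi .re) (by linarith) (hruns i hi)
  -- the computed factor and the computed solution, as approximate solutions of their systems
  have hres : vecNorm (c - C *ᵥ r) ≤ 4 * (32 * g₂) * frobNorm R ^ 2 * vecNorm r := by
    refine vecNorm_residual_le (q := q) (by positivity) (by linarith) (fun i j => ?_)
      (fun i => ?_) (fun i => ?_)
    · have := norm_sub_cholRows_le_of_lt h.chol (by linarith) (isHermArray_compGram δ H)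
        (Or.inl i.2) le_rfl i.2 j.2 hruns
      rw [Finset.sum_range, Finset.sum_range] at this
      exact this
    · have := norm_sub_fwdSubst_le h.fwd (by linarith) htri hdiag hd (compRhs δ H z) i.2
      rw [Finset.sum_range, Finset.sum_range] at this
      exact this
    · have := norm_sub_bwdSubst_le h.bwd (by linarith) htri hdiag hd
        (fwdSubst δ (neFactor δ H) (compRhs δ H z) K) i.2
      rw [Finset.sum_range, Finset.sum_range] at this
      exact this
  have hFR : frobNorm R ^ 2 ≤ 4 * frobNorm H ^ 2 := by
    rw [frobNorm_sq R, Finset.sum_comm]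
    have h0 : ∀ j : Fin K, ∑ i, ‖R i j‖ ^ 2 ≤ 2 * (compGram δ H j j).re := fun j => by
      have := sum_norm_sq_cholRows_le h.chol hg₂ (isHermArray_compGram δ H) j.2 le_rfl hruns
      rw [Finset.sum_range] at this
      exact this
    refine (Finset.sum_le_sum fun j _ => h0 j).trans ?_
    have := sum_re_compGram_le h.gram h₁ hg₁ H
    rw [Finset.sum_range] at this
    rw [← Finset.mul_sum]
    linarith
  have hgram : vecNorm ((C - Hᴴ * H) *ᵥ r) ≤ 2 * g₁ * frobNorm H ^ 2 * vecNorm r := by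
    refine vecNorm_mulVec_le_of_norm_le (by positivity) (fun i k => ?_) r
    have := norm_compGram_sub_le h.gram h₁ H i.2 k.2
    rw [Finset.sum_range, Finset.sum_range] at this
    simp only [entry_apply] at this
    exact this
  have hrhs : vecNorm (Hᴴ *ᵥ z - c) ≤ 2 * g₁ * frobNorm H * vecNorm z := by
    rw [← frobNorm_conjTranspose]
    refine vecNorm_le_of_norm_le (by positivity) (fun i => ?_)
    have := norm_compRhs_sub_le (h.rhs i i.2) h₁ H z
    rw [Finset.sum_range, Finset.sum_range] at this
    simp only [entry_apply, ventry_apply] at this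
    rw [Pi.sub_apply, norm_sub_rev]
    simp only [Matrix.conjTranspose_apply, norm_star]
    exact this
  have hsplit : (Hᴴ * H) *ᵥ (r₀ - r) = (Hᴴ *ᵥ z - c) + (c - C *ᵥ r) + (C - Hᴴ * H) *ᵥ r := by
    rw [Matrix.mulVec_sub, hr₀, gram_mulVec_zf hH, Matrix.sub_mulVec]
    abel
  have hback : r₀ - r = (Hᴴ * H)⁻¹ *ᵥ ((Hᴴ * H) *ᵥ (r₀ - r)) := by
    rw [Matrix.mulVec_mulVec, Matrix.nonsing_inv_mul _ hH, Matrix.one_mulVec]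
  have hFK : frobNorm H ≤ √(K : ℝ) * specNorm H := by
    refine (pow_le_pow_iff_left₀ (frobNorm_nonneg H) ?_ two_ne_zero).1 ?_
    · exact mul_nonneg (Real.sqrt_nonneg _) (specNorm_nonneg H)
    · rwa [mul_pow, Real.sq_sqrt (Nat.cast_nonneg K)]
  have hcr : vecNorm (Hᴴ *ᵥ z) ≤ specNorm (Hᴴ * H) * vecNorm r₀ := by
    rw [← gram_mulVec_zf hH]
    exact vecNorm_mulVec_le _ _
  set N := specNorm (Hᴴ * H)
  set I := specNorm (Hᴴ * H)⁻¹
  have hN : 0 ≤ N := specNorm_nonneg _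
  have hκ : cond2 (Hᴴ * H) = N * I := rfl
  rw [hκ] at hκ₁ hκ₂ ⊢
  have hK0 : (0 : ℝ) ≤ K := Nat.cast_nonneg K
  have hrn := vecNorm_nonneg r
  have hrn₀ := vecNorm_nonneg r₀
  have hrhs' : vecNorm (Hᴴ *ᵥ z - c) ≤ 2 * g₁ * √(K : ℝ) * τ * N * vecNorm r₀ := by
    calc _ ≤ 2 * g₁ * frobNorm H * vecNorm z := hrhs
      _ ≤ 2 * g₁ * (√(K : ℝ) * specNorm H) * vecNorm z := by
          gcongr
          exact vecNorm_nonneg z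
      _ = 2 * g₁ * √(K : ℝ) * (specNorm H * vecNorm z) := by ring
      _ ≤ 2 * g₁ * √(K : ℝ) * (τ * (N * vecNorm r₀)) := by
          exact mul_le_mul_of_nonneg_left
            (hstab.trans (mul_le_mul_of_nonneg_left hcr hτ)) (by positivity)
      _ = _ := by ring
  have hres' : vecNorm (c - C *ᵥ r) ≤ 512 * g₂ * K * N * vecNorm r := by
    refine hres.trans (mul_le_mul_of_nonneg_right ?_ hrn)
    have := mul_le_mul_of_nonneg_left (hFR.trans (mul_le_mul_of_nonneg_left hF zero_le_four)) h₂
    linarith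
  have hgram' : vecNorm ((C - Hᴴ * H) *ᵥ r) ≤ 2 * g₁ * K * N * vecNorm r := by
    refine hgram.trans (mul_le_mul_of_nonneg_right ?_ hrn)
    have := mul_le_mul_of_nonneg_left hF h₁
    linarith
  have he : vecNorm (r₀ - r) ≤ I * (2 * g₁ * √(K : ℝ) * τ * N * vecNorm r₀ +
      512 * g₂ * K * N * vecNorm r + 2 * g₁ * K * N * vecNorm r) := by
    rw [hback]
    refine (vecNorm_mulVec_le _ _).trans (mul_le_mul_of_nonneg_left ?_ hI.le)
    rw [hsplit]
    refine (vecNorm_add_le _ _).trans (add_le_add ((vecNorm_add_le _ _).trans ?_) hgram')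
    exact add_le_add hrhs' hres'
  have hr : vecNorm r ≤ vecNorm r₀ + vecNorm (r₀ - r) := by
    calc vecNorm r = vecNorm (r₀ + (r - r₀)) := by rw [add_sub_cancel]
      _ ≤ _ := (vecNorm_add_le _ _).trans_eq (by rw [vecNorm_sub_rev r r₀])
  rw [vecNorm_sub_rev]
  -- `a` is the relative perturbation of the Gram matrix times the condition number
  set a := (512 * g₂ * K + 2 * g₁ * K) * (N * I) with ha
  have ha0 : 0 ≤ a := by positivity
  have ha1 : a ≤ 1 / 2 := by rw [ha]; linarith
  have he' : vecNorm (r₀ - r) ≤ 2 * g₁ * √(K : ℝ) * τ * (N * I) * vecNorm r₀ +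
      a * vecNorm r := he.trans_eq (by rw [ha]; ring)
  have h8 := mul_le_mul_of_nonneg_left hr ha0
  have h9 := mul_le_mul_of_nonneg_right ha1 (vecNorm_nonneg (r₀ - r))
  have h10 : vecNorm (r₀ - r) ≤ 2 * (2 * g₁ * √(K : ℝ) * τ * (N * I) * vecNorm r₀ +
      a * vecNorm r₀) := by linarith
  refine h10.trans_eq ?_
  rw [ha]
  ring

end Solve

/-! ### Products of rounding factors with high probability -/

lemma abs_prod_one_add_sub_one_le {ι : Type*} (S : Finset ι) (d : ι → ℝ) {u s : ℝ}
    (hu : u ≤ 1 / 2) (hd : ∀ o ∈ S, |d o| ≤ u) (hs : |∑ o ∈ S, d o| ≤ s) :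
    |∏ o ∈ S, (1 + d o) - 1| ≤ Real.exp (s + 2 * S.card * u ^ 2) - 1 := by
  have hpos : ∀ o ∈ S, 0 ≤ 1 + d o := fun o ho => by linarith [(abs_le.1 (hd o ho)).1]
  have hup : ∏ o ∈ S, (1 + d o) ≤ Real.exp (∑ o ∈ S, d o) := by
    rw [Real.exp_sum]
    exact Finset.prod_le_prod hpos fun o _ => by linarith [Real.add_one_le_exp (d o)]
  have hlow : Real.exp (∑ o ∈ S, (d o - 2 * u ^ 2)) ≤ ∏ o ∈ S, (1 + d o) := by
    rw [Real.exp_sum]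
    refine Finset.prod_le_prod (fun _ _ => (Real.exp_pos _).le) fun o ho => ?_
    -- `exp (d / (1 + d)) ≤ 1 + d`, from the tangent bound for `1 / (1 + d) = 1 - d / (1 + d)`
    have h := abs_le.1 (hd o ho)
    have hp : 0 < 1 + d o := by linarith
    have h1 := Real.add_one_le_exp (-(d o / (1 + d o)))
    have h2 : -(d o / (1 + d o)) + 1 = (1 + d o)⁻¹ := by field_simp; ring
    rw [h2, Real.exp_neg] at h1
    have h3 := (inv_le_inv₀ hp (Real.exp_pos _)).1 h1
    refine (Real.exp_le_exp.2 ?_).trans h3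
    rw [le_div_iff₀ hp]
    have h4 : d o ^ 2 ≤ u ^ 2 := sq_le_sq' h.1 h.2
    nlinarith [sq_nonneg u]
  rw [Finset.sum_sub_distrib, Finset.sum_const, nsmul_eq_mul] at hlow
  have hS : 0 ≤ 2 * (S.card : ℝ) * u ^ 2 := by positivity
  set w := s + 2 * S.card * u ^ 2
  have h1 : ∏ o ∈ S, (1 + d o) ≤ Real.exp w :=
    hup.trans (Real.exp_le_exp.2 (by linarith [(abs_le.1 hs).2]))
  have h2 : Real.exp (-w) ≤ ∏ o ∈ S, (1 + d o) :=
    hlow.trans' (Real.exp_le_exp.2 (by linarith [(abs_le.1 hs).1]))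
  rw [abs_le]
  constructor <;> linarith [Real.add_one_le_exp w, Real.add_one_le_exp (-w)]

section Probability

variable {Ω : Type*} [MeasurableSpace Ω] {μ : Measure Ω}

lemma measure_not_and_le {P Q : Ω → Prop} {c d : ℝ} (hc : 0 ≤ c) (hd : 0 ≤ d)
    (hP : μ {ω | ¬ P ω} ≤ ENNReal.ofReal c) (hQ : μ {ω | ¬ Q ω} ≤ ENNReal.ofReal d) :
    μ {ω | ¬ (P ω ∧ Q ω)} ≤ ENNReal.ofReal (c + d) := by
  rw [ENNReal.ofReal_add hc hd]
  refine (measure_mono ?_).trans ((measure_union_le _ _).trans (add_le_add hP hQ))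
  intro ω hω
  by_cases h : P ω
  · exact Or.inr fun h' => hω ⟨h, h'⟩
  · exact Or.inl h

lemma measure_not_forall_lt_le {P : ℕ → Ω → Prop} {n : ℕ} {c : ℝ}
    (hP : ∀ i < n, μ {ω | ¬ P i ω} ≤ ENNReal.ofReal c) :
    μ {ω | ¬ ∀ i < n, P i ω} ≤ ENNReal.ofReal (n * c) := by
  have h1 : {ω | ¬ ∀ i < n, P i ω} ⊆ ⋃ i ∈ Finset.range n, {ω | ¬ P i ω} := by
    intro ω hω
    simpa using hω
  refine (measure_mono h1).trans ((measure_biUnion_finset_le _ _).trans ?_)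
  refine (Finset.sum_le_sum fun i hi => hP i (Finset.mem_range.1 hi)).trans_eq ?_
  rw [Finset.sum_const, Finset.card_range, nsmul_eq_mul, ENNReal.ofReal_mul (Nat.cast_nonneg n),
    ENNReal.ofReal_natCast]

lemma measure_not_forall_part_le {P : Part → Ω → Prop} {c : ℝ} (hc : 0 ≤ c)
    (hP : ∀ p, μ {ω | ¬ P p ω} ≤ ENNReal.ofReal c) :
    μ {ω | ¬ ∀ p, P p ω} ≤ ENNReal.ofReal (2 * c) := by
  have h := measure_not_and_le hc hc (hP .re) (hP .im)
  rw [← two_mul] at h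
  refine (measure_mono fun ω hω => ?_).trans h
  exact fun h' => hω fun p => by cases p <;> [exact h'.1; exact h'.2]

variable [IsProbabilityMeasure μ] {u : ℝ} {δ : Op → Ω → ℝ}

/-- **Hoeffding's inequality** for the rounding errors. -/
lemma measure_abs_sum_gt_le (h : IsRoundingModel μ u δ) (hu : 0 < u) {S : Finset Op} {n : ℕ}
    (hS : S.card ≤ n) {θ : ℝ} (hθ : 0 ≤ θ) :
    μ {ω | ¬ |∑ o ∈ S, δ o ω| ≤ θ * √(n : ℝ) * u} ≤
      ENNReal.ofReal (2 * Real.exp (-(θ ^ 2 / 2))) := by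
  rcases S.eq_empty_or_nonempty with rfl | hne
  · have : {ω : Ω | ¬ |∑ o ∈ (∅ : Finset Op), δ o ω| ≤ θ * √(n : ℝ) * u} = ∅ := by
      ext ω
      simp
      positivity
    rw [this]
    simp
  have hsub : ∀ o ∈ S, HasSubgaussianMGF (δ o) ((‖u - -u‖₊ / 2) ^ 2) μ := fun o _ =>
    hasSubgaussianMGF_of_mem_Icc_of_integral_eq_zero (h.measurable o).aemeasurable
      ((h.bounded o).mono fun ω hω => abs_le.1 hω) (h.mean_zero o)
  have hc0 : (0 : ℝ) < S.card := by exact_mod_cast hne.card_pos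
  have hcn : (S.card : ℝ) ≤ n := by exact_mod_cast hS
  have hε : 0 ≤ θ * √(n : ℝ) * u := by positivity
  have hexp : Real.exp (-(θ * √(n : ℝ) * u) ^ 2 /
      (2 * ((∑ _o ∈ S, (‖u - -u‖₊ / 2) ^ 2 : NNReal) : ℝ))) ≤ Real.exp (-(θ ^ 2 / 2)) := by
    apply Real.exp_le_exp.2
    have h2 : ((∑ _o ∈ S, (‖u - -u‖₊ / 2) ^ 2 : NNReal) : ℝ) = S.card * u ^ 2 := by
      rw [Finset.sum_const, nsmul_eq_mul]
      push_cast
      rw [Real.norm_of_nonneg (by linarith)]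
      ring
    rw [h2, mul_pow, mul_pow, Real.sq_sqrt (Nat.cast_nonneg n), neg_div, neg_le_neg_iff,
      le_div_iff₀ (by positivity)]
    have : 0 ≤ θ ^ 2 * u ^ 2 * (n - S.card) := mul_nonneg (by positivity) (by linarith)
    linarith
  have h1 := (HasSubgaussianMGF.sum_of_iIndepFun h.indep hsub).measure_ge_le hε
  have h2 := (HasSubgaussianMGF.sum_of_iIndepFun h.indep hsub).neg.measure_ge_le hε
  have h3 : {ω | ¬ |∑ o ∈ S, δ o ω| ≤ θ * √(n : ℝ) * u} ⊆
      {ω | θ * √(n : ℝ) * u ≤ ∑ o ∈ S, δ o ω} ∪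
        {ω | θ * √(n : ℝ) * u ≤ (-fun ω => ∑ o ∈ S, δ o ω) ω} := by
    intro ω hω
    simp only [Set.mem_ofPred_eq, not_le, lt_abs] at hω
    rcases hω with hω | hω
    · exact Or.inl hω.le
    · exact Or.inr hω.le
  refine (measure_mono h3).trans ((measure_union_le _ _).trans ?_)
  rw [two_mul, ENNReal.ofReal_add (Real.exp_pos _).le (Real.exp_pos _).le]
  refine add_le_add ?_ ?_
  · rw [← ofReal_measureReal]
    exact ENNReal.ofReal_le_ofReal (h1.trans hexp)
  · rw [← ofReal_measureReal]
    exact ENNReal.ofReal_le_ofReal (h2.trans hexp)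

lemma measure_abs_prod_gt_le (h : IsRoundingModel μ u δ) (hu : 0 < u) (hu' : u ≤ 1 / 2)
    {S : Finset Op} {n : ℕ} (hS : S.card ≤ n) {θ : ℝ} (hθ : 0 ≤ θ) :
    μ {ω | ¬ |∏ o ∈ S, (1 + δ o ω) - 1| ≤
        Real.exp (θ * √(n : ℝ) * u + 2 * n * u ^ 2) - 1} ≤
      ENNReal.ofReal (2 * Real.exp (-(θ ^ 2 / 2))) := by
  refine (measure_mono_ae ?_).trans (measure_abs_sum_gt_le h hu hS hθ)
  have hb : ∀ᵐ ω ∂μ, ∀ o ∈ S, |δ o ω| ≤ u :=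
    (Finset.eventually_all S).2 fun o _ => h.bounded o
  filter_upwards [hb] with ω hω hbad hgood
  refine hbad ((abs_prod_one_add_sub_one_le S _ hu' hω hgood).trans ?_)
  have : (S.card : ℝ) ≤ n := by exact_mod_cast hS
  gcongr

/-- The additions of the slots `a, …, n - 1` in part `p` of the task `T`. -/
def addOps (T : Task) (p : Part) (a n : ℕ) : Finset Op :=
  (Finset.Ico a n).map ⟨fun s => (T, p, Slot.add s), fun s t h => by simpa using h⟩

/-- The `t`-th product and the additions of the slots `a, …, n - 1` in part `p` of the task `T`. -/
def termOps (T : Task) (p : Part) (t a n : ℕ) : Finset Op :=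
  Finset.cons (T, p, Slot.mul t) (addOps T p a n) (by
    simp only [addOps, Finset.mem_map]
    rintro ⟨s, -, hs⟩
    exact absurd (congrArg (fun o : Op => o.2.2) hs) Slot.noConfusion)

lemma prod_addOps (f : Op → ℝ) (T : Task) (p : Part) (a n : ℕ) :
    ∏ o ∈ addOps T p a n, f o = ∏ s ∈ Finset.Ico a n, f (T, p, .add s) :=
  Finset.prod_map _ _ _

lemma prod_termOps (f : Op → ℝ) (T : Task) (p : Part) (t a n : ℕ) :
    ∏ o ∈ termOps T p t a n, f o =
      f (T, p, .mul t) * ∏ s ∈ Finset.Ico a n, f (T, p, .add s) := by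
  rw [termOps, Finset.prod_cons, prod_addOps]

lemma card_addOps (T : Task) (p : Part) (a n : ℕ) : (addOps T p a n).card = n - a := by
  rw [addOps, Finset.card_map, Nat.card_Ico]

lemma card_termOps (T : Task) (p : Part) (t a n : ℕ) :
    (termOps T p t a n).card = n - a + 1 := by
  rw [termOps, Finset.card_cons, card_addOps]

variable {T : Task} {p : Part} {n N : ℕ} {θ : ℝ}

lemma measure_not_dotGood_le (h : IsRoundingModel μ u δ) (hu : 0 < u) (hu' : u ≤ 1 / 2)
    (hθ : 0 ≤ θ) (hn : n ≤ N) :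
    μ {ω | ¬ DotGood (taskErr (fun o => δ o ω) T p) n
        (Real.exp (θ * √(N : ℝ) * u + 2 * N * u ^ 2) - 1)} ≤
      ENNReal.ofReal (n * (2 * Real.exp (-(θ ^ 2 / 2)))) := by
  refine measure_not_forall_lt_le fun t ht => ?_
  have hcard : (termOps T p t (max 1 t) n).card ≤ N := by
    rw [card_termOps]
    omega
  have := measure_abs_prod_gt_le h hu hu' hcard hθ
  simp only [prod_termOps] at this
  exact this

lemma measure_not_subGood_le (h : IsRoundingModel μ u δ) (hu : 0 < u) (hu' : u ≤ 1 / 2)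
    (hθ : 0 ≤ θ) (hn : n + 1 ≤ N) :
    μ {ω | ¬ SubGood (taskErr (fun o => δ o ω) T p) n
        (Real.exp (θ * √(N : ℝ) * u + 2 * N * u ^ 2) - 1)} ≤
      ENNReal.ofReal ((n + 2) * (2 * Real.exp (-(θ ^ 2 / 2)))) := by
  set e := 2 * Real.exp (-(θ ^ 2 / 2))
  set g := Real.exp (θ * √(N : ℝ) * u + 2 * N * u ^ 2) - 1
  have he : 0 ≤ e := by positivity
  have h1 : μ {ω | ¬ ∀ t < n, |(1 + δ (T, p, .mul t) ω) *
      ∏ s ∈ Finset.Ico t n, (1 + δ (T, p, .add s) ω) - 1| ≤ g} ≤ ENNReal.ofReal (n * e) := by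
    refine measure_not_forall_lt_le fun t ht => ?_
    have hcard : (termOps T p t t n).card ≤ N := by
      rw [card_termOps]
      omega
    have := measure_abs_prod_gt_le h hu hu' hcard hθ
    simp only [prod_termOps] at this
    exact this
  have h2 : μ {ω | ¬ |∏ s ∈ Finset.range n, (1 + δ (T, p, .add s) ω) - 1| ≤ g} ≤
      ENNReal.ofReal e := by
    have hcard : (addOps T p 0 n).card ≤ N := by
      rw [card_addOps]
      omega
    have := measure_abs_prod_gt_le h hu hu' hcard hθ
    simp only [prod_addOps, ← Finset.range_eq_Ico] at this
    exact this
  have h3 : μ {ω | ¬ |δ (T, p, .last) ω| ≤ g} ≤ ENNReal.ofReal e := by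
    have hcard : ({(T, p, .last)} : Finset Op).card ≤ N := by simp; omega
    have := measure_abs_prod_gt_le h hu hu' hcard hθ
    simp only [Finset.prod_singleton, add_sub_cancel_left] at this
    exact this
  have h4 := measure_not_and_le (by positivity) (by positivity) h1
    (measure_not_and_le he he h2 h3)
  rw [show (n + 2) * e = n * e + (e + e) by ring]
  refine le_trans (measure_mono ?_) h4
  rintro ω hω hgood
  exact hω ⟨hgood.1, hgood.2.1, hgood.2.2⟩

/-- Union bound over all accumulated products of rounding factors. -/
lemma measure_not_errorsBounded_le (h : IsRoundingModel μ u δ) (hu : 0 < u) (hu' : u ≤ 1 / 2)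
    (hθ : 0 ≤ θ) {M K : ℕ} (hK : 1 ≤ K) :
    μ {ω | ¬ ErrorsBounded (fun o => δ o ω) M K
        (Real.exp (θ * √((2 * M : ℕ) : ℝ) * u + 2 * (2 * M : ℕ) * u ^ 2) - 1)
        (Real.exp (θ * √((2 * K + 1 : ℕ) : ℝ) * u + 2 * (2 * K + 1 : ℕ) * u ^ 2) - 1)} ≤
      ENNReal.ofReal (24 * (K : ℝ) ^ 2 * ((M : ℝ) + K) * Real.exp (-(θ ^ 2 / 2))) := by
  set e := 2 * Real.exp (-(θ ^ 2 / 2)) with he'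
  have he : 0 ≤ e := by positivity
  have hsub : ∀ (T : Task) (p : Part) (n : ℕ), n + 2 ≤ 2 * K →
      μ {ω | ¬ SubGood (taskErr (fun o => δ o ω) T p) n
        (Real.exp (θ * √((2 * K + 1 : ℕ) : ℝ) * u + 2 * (2 * K + 1 : ℕ) * u ^ 2) - 1)} ≤
      ENNReal.ofReal (2 * K * e) := fun T p n hn =>
    (measure_not_subGood_le h hu hu' hθ (by omega)).trans (ENNReal.ofReal_le_ofReal
      (mul_le_mul_of_nonneg_right (by exact_mod_cast hn) he))
  have hdot := fun (T : Task) (p : Part) =>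
    measure_not_dotGood_le (T := T) (p := p) h hu hu' hθ (le_refl (2 * M))
  have h1 := measure_not_forall_lt_le (n := K) fun i _ =>
    measure_not_forall_part_le (by positivity) fun p => hdot (.rhs i) p
  have h2 := measure_not_forall_lt_le (n := K) fun i _ =>
    measure_not_forall_lt_le (n := K) fun j _ =>
      measure_not_forall_part_le (by positivity) fun p => hdot (.gram i j) p
  have h3 := measure_not_forall_lt_le (n := K) fun i hi =>
    measure_not_forall_lt_le (n := K) fun j _ =>
      measure_not_forall_part_le (by positivity) fun p => hsub (.chol i j) p (2 * i) (by omega)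
  have h4 := measure_not_forall_lt_le (n := K) fun i hi =>
    measure_not_forall_part_le (by positivity) fun p => hsub (.fwd i) p (2 * i) (by omega)
  have h5 := measure_not_forall_lt_le (n := K) fun i hi =>
    measure_not_forall_part_le (by positivity) fun p =>
      hsub (.bwd i) p (2 * (K - 1 - i)) (by omega)
  have h6 := measure_not_and_le (by positivity) (by positivity) h1
    (measure_not_and_le (by positivity) (by positivity) h2
      (measure_not_and_le (by positivity) (by positivity) h3
        (measure_not_and_le (by positivity) (by positivity) h4 h5)))
  refine (le_trans (measure_mono ?_) h6).trans (ENNReal.ofReal_le_ofReal ?_)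
  · rintro ω hω hgood
    exact hω ⟨hgood.1, hgood.2.1, hgood.2.2.1, hgood.2.2.2.1, hgood.2.2.2.2⟩
  · have hK1 : (1 : ℝ) ≤ K := by exact_mod_cast hK
    have hM : (0 : ℝ) ≤ M := Nat.cast_nonneg M
    have hx : Real.exp (-(θ ^ 2 / 2)) = e / 2 := by rw [he']; ring
    rw [hx]
    push_cast
    have h7 : 0 ≤ K * M * e * ((K : ℝ) - 1) := mul_nonneg (by positivity) (by linarith)
    have h8 : 0 ≤ (K : ℝ) ^ 2 * e * ((K : ℝ) - 1) := mul_nonneg (by positivity) (by linarith)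
    have h9 : 0 ≤ (K : ℝ) ^ 2 * M * e := by positivity
    have h10 : 0 ≤ (K : ℝ) ^ 3 * e := by positivity
    linarith

end Probability

/-! ### Comparison with the constants `γ` and `c` -/

section Constants

variable {lam u : ℝ}

lemma mul_sqrt_mul_le_gam (hu1 : u < 1) (n : ℕ) : lam * √(n : ℝ) * u ≤ gam lam u n := by
  have h : 0 ≤ n * u ^ 2 / (1 - u) := div_nonneg (by positivity) (by linarith)
  have := Real.add_one_le_exp (lam * √(n : ℝ) * u + n * u ^ 2 / (1 - u))
  rw [gam]
  linarith

lemma gam_nonneg (hlam : 0 ≤ lam) (hu : 0 ≤ u) (hu1 : u < 1) (n : ℕ) : 0 ≤ gam lam u n :=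
  (mul_sqrt_mul_le_gam hu1 n).trans' (by positivity)

lemma gam_mono (hlam : 0 ≤ lam) (hu : 0 ≤ u) (hu1 : u < 1) {m n : ℕ} (h : m ≤ n) :
    gam lam u m ≤ gam lam u n := by
  have h' : (m : ℝ) ≤ n := by exact_mod_cast h
  have : 0 < 1 - u := by linarith
  rw [gam, gam]
  gcongr

/-- At the deviation level `lam / (D τ)` the accumulated errors are much smaller than `γ_n`: the
second-order term is negligible because `n u² = (lam √n u)² / lam²` and `lam ≥ D τ`. -/
lemma exp_sub_one_le_gam (hu : 0 < u) (hu1 : u < 1) {n : ℕ} {D τ : ℝ} (hD : 6 ≤ D)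
    (hτ : 1 ≤ τ) (hlam : D * τ ≤ lam) (hγ : gam lam u n ≤ 1) :
    Real.exp (lam / (D * τ) * √(n : ℝ) * u + 2 * n * u ^ 2) - 1 ≤
      6 / (D * τ) * gam lam u n := by
  have hx1 := mul_sqrt_mul_le_gam (lam := lam) hu1 n
  have hDτ : 6 ≤ D * τ := by nlinarith
  have hlam0 : 0 < lam := by linarith
  set x := lam * √(n : ℝ) * u with hx
  have hx0 : 0 ≤ x := by positivity
  have h1 : lam / (D * τ) * √(n : ℝ) * u = x / (D * τ) := by rw [hx]; ring
  have h2 : 2 * n * u ^ 2 ≤ 2 * x / (D * τ) := by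
    have h3 : lam ^ 2 * (n * u ^ 2) = x ^ 2 := by
      rw [hx, mul_pow, mul_pow, Real.sq_sqrt (Nat.cast_nonneg n)]
      ring
    have h4 : 0 ≤ (n : ℝ) * u ^ 2 := by positivity
    rw [le_div_iff₀ (by linarith)]
    have h5 : D * τ ≤ lam ^ 2 := by nlinarith
    have h6 := mul_le_mul_of_nonneg_right h5 h4
    have h7 : x ^ 2 ≤ x := by nlinarith
    linarith
  have h3 : lam / (D * τ) * √(n : ℝ) * u + 2 * n * u ^ 2 ≤ 3 * x / (D * τ) := by
    rw [h1]
    refine (add_le_add_right h2 _).trans_eq ?_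
    ring
  have hy0 : 0 ≤ 3 * x / (D * τ) := by positivity
  have hy1 : 3 * x / (D * τ) ≤ 1 := by
    rw [div_le_one (by linarith)]
    linarith
  have h4 := (le_abs_self _).trans (Real.abs_exp_sub_one_le (x := 3 * x / (D * τ))
    (by rwa [abs_of_nonneg hy0]))
  rw [abs_of_nonneg hy0] at h4
  calc _ ≤ Real.exp (3 * x / (D * τ)) - 1 := sub_le_sub_right (Real.exp_le_exp.2 h3) 1
    _ ≤ 2 * (3 * x / (D * τ)) := h4
    _ = 6 / (D * τ) * x := by ring
    _ ≤ _ := mul_le_mul_of_nonneg_left hx1 (by positivity)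

lemma le_c1 (hlam : 0 ≤ lam) (hu : 0 ≤ u) (hu1 : u < 1) {M K : ℕ}
    (h : 2 * K * gam lam u (2 * K + 1) < 1) :
    2 * K * gam lam u (2 * M) + 2 * K * gam lam u (2 * K + 1) ≤ c1 lam u M K := by
  have h0 := gam_nonneg hlam hu hu1 (2 * K + 1)
  have h1 : gam lam u (2 * K + 1) ≤ gam lam u (6 * K + 1) := gam_mono hlam hu hu1 (by omega)
  have h2 : 0 ≤ 2 * (K : ℝ) * gam lam u (2 * K + 1) := by positivity
  have h3 : gam lam u (6 * K + 1) ≤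
      gam lam u (6 * K + 1) / (1 - 2 * K * gam lam u (2 * K + 1)) := by
    rw [le_div_iff₀ (by linarith)]
    nlinarith
  rw [c1, ← mul_add]
  gcongr
  exact h1.trans h3

lemma one_le_cond2 {M K : ℕ} {H : Matrix (Fin M) (Fin K) ℂ} (hH : IsUnit (Hᴴ * H).det)
    (hK : 1 ≤ K) : 1 ≤ cond2 (Hᴴ * H) := by
  have h1 := vecNorm_mulVec_le (Hᴴ * H)⁻¹ ((Hᴴ * H) *ᵥ fun _ => 1)
  rw [Matrix.mulVec_mulVec, Matrix.nonsing_inv_mul _ hH, Matrix.one_mulVec] at h1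
  have h2 := mul_le_mul_of_nonneg_left (vecNorm_mulVec_le (Hᴴ * H) fun _ => 1)
    (specNorm_nonneg (Hᴴ * H)⁻¹)
  have h3 : 0 < vecNorm (fun _ : Fin K => (1 : ℂ)) := by
    refine (vecNorm_nonneg _).lt_of_ne fun h0 => ?_
    have h4 := vecNorm_sq (fun _ : Fin K => (1 : ℂ))
    rw [← h0] at h4
    have h5 : (1 : ℝ) ≤ K := by exact_mod_cast hK
    simp at h4
    linarith
  rw [cond2]
  nlinarith

end Constants

/-- The method succeeds with the stated accuracy whenever the accumulated rounding errors are at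
most `6 γ / (10⁵ τ)`. -/
lemma neRuns_and_vecNorm_le {M K : ℕ} (hK : 1 ≤ K) {H : Matrix (Fin M) (Fin K) ℂ}
    (hH : IsUnit (Hᴴ * H).det) {z : Fin M → ℂ} {u lam τ : ℝ} (hu : 0 < u) (hu1 : u < 1)
    (hlam : 0 < lam) (hγ : 2 * K * gam lam u (2 * K + 1) < 1)
    (hc : c1 lam u M K * cond2 (Hᴴ * H) < 1) (hτ : 1 ≤ τ)
    (hstab : specNorm H * vecNorm z ≤ τ * vecNorm (Hᴴ *ᵥ z)) {δ : Op → ℝ} {g₁ g₂ : ℝ}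
    (h : ErrorsBounded δ M K g₁ g₂) (h₁ : 0 ≤ g₁) (h₂ : 0 ≤ g₂)
    (hg₁ : g₁ ≤ 6 / (100000 * τ) * gam lam u (2 * M))
    (hg₂ : g₂ ≤ 6 / (100000 * τ) * gam lam u (2 * K + 1)) :
    NERuns δ H ∧ vecNorm (neSolve δ H z - (zfMatrix H)ᴴ *ᵥ z) ≤
      cU lam u M K * cond2 (Hᴴ * H) * vecNorm ((zfMatrix H)ᴴ *ᵥ z) := by
  have hκ := one_le_cond2 hH hK
  have hK1 : (1 : ℝ) ≤ K := by exact_mod_cast hK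
  have hc1 := le_c1 (M := M) hlam.le hu.le hu1 hγ
  have hγ₁ := gam_nonneg hlam.le hu.le hu1 (2 * M)
  have hγ₂ := gam_nonneg hlam.le hu.le hu1 (2 * K + 1)
  set γ₁ := gam lam u (2 * M)
  set γ₂ := gam lam u (2 * K + 1)
  set κ := cond2 (Hᴴ * H)
  have hτ₁ : 100000 * (τ * g₁) ≤ 6 * γ₁ := by
    rw [div_mul_eq_mul_div, le_div_iff₀ (by positivity)] at hg₁
    linarith
  have hτ₂ : 100000 * (τ * g₂) ≤ 6 * γ₂ := by
    rw [div_mul_eq_mul_div, le_div_iff₀ (by positivity)] at hg₂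
    linarith
  have hs₁ : 100000 * g₁ ≤ 6 * γ₁ := by nlinarith
  have hs₂ : 100000 * g₂ ≤ 6 * γ₂ := by nlinarith
  have hKκ : (1 : ℝ) ≤ K * κ := by nlinarith
  have hsum : 2 * (K * κ) * γ₁ + 2 * (K * κ) * γ₂ < 1 := by
    have := mul_le_mul_of_nonneg_right hc1 (by linarith : 0 ≤ κ)
    linarith
  have hp₁ : 0 ≤ K * κ * γ₁ := by positivity
  have hp₂ : 0 ≤ K * κ * γ₂ := by positivity
  have hq₁ := mul_le_mul_of_nonneg_left hs₁ (by linarith : 0 ≤ K * κ)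
  have hq₂ := mul_le_mul_of_nonneg_left hs₂ (by linarith : 0 ≤ K * κ)
  have hr₁ : γ₁ ≤ K * κ * γ₁ := by nlinarith
  have hr₂ : γ₂ ≤ K * κ * γ₂ := by nlinarith
  have hg₁' : 2 * g₁ ≤ 1 := by linarith
  have hg₂' : 128 * g₂ ≤ 1 := by linarith
  have hκ₁ : 8 * g₁ * K * κ ≤ 1 := by linarith
  have hκ₂ : 4096 * g₂ * K * κ ≤ 1 := by linarith
  refine ⟨neRuns_of_errorsBounded h hK hH h₁ h₂ hg₁' hg₂' hκ₁ hκ₂,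
    (vecNorm_neSolve_sub_le h hK hH h₁ h₂ hg₁' hg₂' hκ₁ hκ₂ (by linarith) hstab).trans ?_⟩
  refine mul_le_mul_of_nonneg_right (mul_le_mul_of_nonneg_right ?_ (by linarith))
    (vecNorm_nonneg _)
  have hsq : √(K : ℝ) ≤ √(2 * (K : ℝ)) := Real.sqrt_le_sqrt (by linarith)
  have h3 : 4 * (τ * g₁) * √(K : ℝ) ≤ γ₁ * √(2 * (K : ℝ)) := by
    refine mul_le_mul (by linarith) hsq (Real.sqrt_nonneg _) hγ₁
  have h4 := mul_le_mul_of_nonneg_left hs₁ (by linarith : (0 : ℝ) ≤ K)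
  have h5 := mul_le_mul_of_nonneg_left hs₂ (by linarith : (0 : ℝ) ≤ K)
  have h6 : 0 ≤ K * γ₁ := by positivity
  have h7 : 0 ≤ K * γ₂ := by positivity
  rw [cU]
  linarith

end FinitePrecisionZF

theorem lemma4 :
    ∃ A b : ℝ, 0 < A ∧ 0 < b ∧
      ∀ (M K : ℕ) (_ : 1 ≤ K)
        -- full column rank channel, transmitted signals, noise, received signals
        (H : Matrix (Fin M) (Fin K) ℂ) (_ : H.rank = K)
        (ρ : ℝ) (_ : 0 ≤ ρ) (x : Fin K → ℂ) (n z : Fin M → ℂ)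
        (_ : z = (√ρ : ℂ) • (H *ᵥ x) + n)
        -- unit roundoff, and the parameter controlling the failure probability
        (u lam : ℝ) (_ : 0 < u) (_ : u < 1) (_ : 0 < lam)
        (_ : 2 * K * FinitePrecisionZF.gam lam u (2 * K + 1) < 1)
        (_ : FinitePrecisionZF.c1 lam u M K * FinitePrecisionZF.cond2 (Hᴴ * H) < 1)
        -- backward stability: `‖H‖₂ ‖z‖₂` and `‖Hᴴ z‖₂` agree up to the factor `τ`
        (τ : ℝ) (_ : 1 ≤ τ)
        (_ : FinitePrecisionZF.specNorm H * FinitePrecisionZF.vecNorm z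
          ≤ τ * FinitePrecisionZF.vecNorm (Hᴴ *ᵥ z))
        -- random rounding errors
        (Ω : Type*) [MeasurableSpace Ω] (μ : Measure Ω) [IsProbabilityMeasure μ]
        (δ : FinitePrecisionZF.Op → Ω → ℝ)
        (_ : FinitePrecisionZF.IsRoundingModel μ u δ),
        ∃ Δr : Ω → Fin K → ℂ,
          (∀ ω, FinitePrecisionZF.neSolve (fun o => δ o ω) H z
            = (FinitePrecisionZF.zfMatrix H)ᴴ *ᵥ z + Δr ω) ∧
          μ {ω | ¬ (FinitePrecisionZF.NERuns (fun o => δ o ω) H ∧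
              FinitePrecisionZF.vecNorm (Δr ω)
                ≤ FinitePrecisionZF.cU lam u M K * FinitePrecisionZF.cond2 (Hᴴ * H)
                  * FinitePrecisionZF.vecNorm ((FinitePrecisionZF.zfMatrix H)ᴴ *ᵥ z))}
            ≤ ENNReal.ofReal
                (A * (K : ℝ) ^ 2 * ((M : ℝ) + K) * Real.exp (-(b * lam ^ 2 / τ ^ 2))) ∧
          ∀ ω k,
            FinitePrecisionZF.neSolve (fun o => δ o ω) H z k
              = (√ρ : ℂ) * x k
                + (√ρ : ℂ) * ∑ i ∈ Finset.univ.erase k,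
                    (star ((FinitePrecisionZF.zfMatrix H).col k) ⬝ᵥ H.col i) * x i
                + star ((FinitePrecisionZF.zfMatrix H).col k) ⬝ᵥ n + Δr ω k ∧
            FinitePrecisionZF.neSolve (fun o => δ o ω) H z k
              = (√ρ : ℂ) * x k
                + star ((FinitePrecisionZF.zfMatrix H).col k) ⬝ᵥ n + Δr ω k := by
  -- with `θ = lam / (D τ)` and `D = 10⁵`, the exponent `θ² / 2` is `lam² / (2 D² τ²)`
  refine ⟨24, 1 / (2 * 100000 ^ 2), by norm_num, by norm_num, ?_⟩
  intro M K hK H hrank ρ _ x n z hz u lam hu hu1 hlam hγ hc τ hτ hstab Ω _ μ _ δ hδ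
  have hH := FinitePrecisionZF.isUnit_det_conjTranspose_mul_self hrank
  have hAH := FinitePrecisionZF.conjTranspose_zfMatrix_mul_self hH
  refine ⟨fun ω => FinitePrecisionZF.neSolve (fun o => δ o ω) H z -
    (FinitePrecisionZF.zfMatrix H)ᴴ *ᵥ z, fun ω => by rw [add_sub_cancel], ?_, ?_⟩
  · have hK1 : (1 : ℝ) ≤ K := by exact_mod_cast hK
    rcases lt_or_ge lam (100000 * τ) with hsmall | hlarge
    · -- the bound on the probability exceeds `1`
      refine prob_le_one.trans (ENNReal.one_le_ofReal.2 ?_)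
      have h1 : 1 / (2 * 100000 ^ 2) * lam ^ 2 / τ ^ 2 ≤ 1 / 2 := by
        rw [div_le_iff₀ (by positivity)]
        have := pow_le_pow_left₀ hlam.le hsmall.le 2
        nlinarith
      have h2 : 1 / 2 ≤ Real.exp (-(1 / (2 * 100000 ^ 2) * lam ^ 2 / τ ^ 2)) := by
        have := Real.add_one_le_exp (-(1 / (2 * 100000 ^ 2) * lam ^ 2 / τ ^ 2))
        linarith
      have h3 : (1 : ℝ) ≤ (K : ℝ) ^ 2 * ((M : ℝ) + K) := by
        have : (0 : ℝ) ≤ M := Nat.cast_nonneg M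
        exact one_le_mul_of_one_le_of_one_le (one_le_pow₀ hK1) (by linarith)
      nlinarith
    · have hγ₂ := FinitePrecisionZF.gam_nonneg hlam.le hu.le hu1 (2 * K + 1)
      have hγ₁ := FinitePrecisionZF.gam_nonneg hlam.le hu.le hu1 (2 * M)
      have hγ₂1 : FinitePrecisionZF.gam lam u (2 * K + 1) ≤ 1 := by nlinarith
      have hγ₁1 : FinitePrecisionZF.gam lam u (2 * M) ≤ 1 := by
        have h1 := FinitePrecisionZF.le_c1 (M := M) hlam.le hu.le hu1 hγ
        have h2 := FinitePrecisionZF.one_le_cond2 hH hK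
        have h3 : 0 ≤ FinitePrecisionZF.c1 lam u M K := h1.trans' (by positivity)
        nlinarith
      have hu2 : u ≤ 1 / 2 := by
        have h1 := FinitePrecisionZF.mul_sqrt_mul_le_gam (lam := lam) hu1 (2 * K + 1)
        have h2 : 1 ≤ √((2 * K + 1 : ℕ) : ℝ) :=
          Real.one_le_sqrt.2 (by exact_mod_cast (by omega : 1 ≤ 2 * K + 1))
        have h3 : lam * 1 * u ≤ lam * √((2 * K + 1 : ℕ) : ℝ) * u := by gcongr
        nlinarith
      have hθ : 0 ≤ lam / (100000 * τ) := by positivity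
      refine (measure_mono ?_).trans ((FinitePrecisionZF.measure_not_errorsBounded_le
        (M := M) hδ hu hu2 hθ hK).trans_eq ?_)
      · rintro ω hω hgood
        refine hω (FinitePrecisionZF.neRuns_and_vecNorm_le hK hH hu hu1 hlam hγ hc hτ hstab hgood
          (sub_nonneg.2 (Real.one_le_exp (by positivity)))
          (sub_nonneg.2 (Real.one_le_exp (by positivity)))
          (FinitePrecisionZF.exp_sub_one_le_gam hu hu1 (by norm_num) hτ hlarge hγ₁1)
          (FinitePrecisionZF.exp_sub_one_le_gam hu hu1 (by norm_num) hτ hlarge hγ₂1))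
      · congr 4
        rw [div_pow, mul_pow]
        ring
  · intro ω k
    -- zero forcing removes the interference between users
    have hcol : ∀ i, star ((FinitePrecisionZF.zfMatrix H).col k) ⬝ᵥ H.col i =
        (1 : Matrix (Fin K) (Fin K) ℂ) k i := fun i => by
      rw [← hAH]
      rfl
    have hzf : ((FinitePrecisionZF.zfMatrix H)ᴴ *ᵥ z) k =
        (√ρ : ℂ) * x k + star ((FinitePrecisionZF.zfMatrix H).col k) ⬝ᵥ n := by
      rw [hz, Matrix.mulVec_add, Matrix.mulVec_smul, Matrix.mulVec_mulVec, hAH,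
        Matrix.one_mulVec]
      rfl
    have hsum : ∑ i ∈ Finset.univ.erase k,
        (star ((FinitePrecisionZF.zfMatrix H).col k) ⬝ᵥ H.col i) * x i = 0 :=
      Finset.sum_eq_zero fun i hi => by
        rw [hcol, Matrix.one_apply_ne (Finset.ne_of_mem_erase hi).symm, zero_mul]
    rw [hsum, mul_zero, add_zero, ← hzf]
    exact ⟨(add_sub_cancel _ _).symm, (add_sub_cancel _ _).symm⟩
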